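/- **Setting.** Let $\Gamma$ be an acyclic perfect network on an oriented cylinder with a cut: a finite directed graph without oriented cycles, embedded in the cylinder, with $N$ univalent sources on one boundary circle and $N$ univalent sinks on the other, and all internal vertices trivalent, each either white (one incoming, two outgoing edges) or black (two incoming, one outgoing edge). Draw the cylinder as a rectangle, its top and bottom being glued along the cut, with sources $1,\dots,N$ from top to bottom on the left side and sinks $1,\dots,N$ from top to bottom on the right side. Let $\mathbf k=\mathbb C(\lambda,\mu)$. Let $\mathcal C$ be the $\mathbf k$-linear category whose objects are the points $1,\dots,N$ obtained by gluing the $i$-th sink to the $i$-th source (so that $\Gamma$ becomes a network on a torus) and whose morphisms $i\to j$ are linear combinations of directed paths in the torus network; $fg$ denotes concatenation, $f$ first. Let $B(z)$ be the boundary measurement matrix, $B(z)_{ij}=\sum_p z^{d(p)}p$, over the paths $p$ in $\Gamma$ from source $i$ to sink $j$, where $d(p)$ is the oriented intersection number of $p$ with the cut (upward crossings count $+1$). **Brackets.** Paths of the torus network carry the double bracket $\{\!\{-,-\}\!\}:\mathrm{Hom}(a,b)\otimes\mathrm{Hom}(c,d)\to\mathrm{Hom}(c,b)\otimes\mathrm{Hom}(a,d)$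 determined by the double Leibniz identities $\{\!\{fg,h\}\!\}=(1\otimes f)\{\!\{g,h\}\!\}+\{\!\{f,h\}\!\}(g\otimes 1)$ and $\{\!\{f,gh\}\!\}=(g\otimes1)\{\!\{f,h\}\!\}+\{\!\{f,g\}\!\}(1\otimes h)$, by skew-symmetry, and by its values on edges, which are sums of the following local contributions of the internal vertices: $\{\!\{x_1,x_2\}\!\}=\tfrac12x_1\otimes x_2$ at a white vertex with outgoing edges $x_1,x_2$ and incoming edge $x_3$, where $(x_1,x_2,x_3)$ is the counter-clockwise order, and $\{\!\{y_1,y_2\}\!\}=-\tfrac12y_2\otimes y_1$ at a black vertex with incoming edges $y_1,y_2$ and outgoing edge $y_3$, where $(y_1,y_2,y_3)$ is the counter-clockwise order. It restricts to $\mathcal C$. Let $\mathcal C_\natural$ be the cyclic space, i.e. linear combinations of loops of $\mathcal C$ modulo all $fg-gf$. Composing the double bracket with concatenation induces a bracket $\{-,-\}:\mathcal C_\natural\otimes\mathcal C\to\mathcal C$. **Completion.** Let $X(\lambda)=B(\lambda)-\mathbf 1$ and let $J$ be a two-sided ideal of $\mathcal C$ containing all entries of $X(\lambda)$, for instance the ideal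 generated by them. Let $\hat{\mathcal C}=\varprojlim\mathcal C/J^m$ and let $\hat{\mathcal C}_\natural=\varprojlim\mathcal C_\natural/\overline{J^m}$, where $\overline{J^m}$ is spanned by the classes of the loops in $J^m$. (When $\mathcal C$ is freely generated by the entries of $X(\lambda)$ and $J$ is the ideal generated by them, $\hat{\mathcal C}$ is the space $\prod_m\mathcal C_{(m)}$ of formal power series in these entries.) The bracket extends continuously to $\{-,-\}:\hat{\mathcal C}_\natural\otimes\hat{\mathcal C}\to\hat{\mathcal C}$. **Proposition (Hamilton flow of $H=\tfrac12\mathrm{tr}(\log B)^2$).** Let $\log B(\lambda)=\sum_{k\ge1}\frac{(-1)^{k+1}}k(B(\lambda)-\mathbf 1)^k$, a matrix over $\hat{\mathcal C}$, and let $H(\lambda)\in\hat{\mathcal C}_\natural$ be the class of $\tfrac12\mathrm{tr}\big((\log B(\lambda))^2\big)$. Then, entrywise in $\hat{\mathcal C}$, $$\{H(\lambda),B(\mu)\}=\widetilde M(\lambda,\mu)\,B(\mu)-B(\mu)\,\widetilde M(\lambda,\mu),\qquad \widetilde M(\lambda,\mu)_{b_1b_2}=\rho_{b_2b_1}(\lambda,\mu)\,\big(\log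 B(\lambda)\big)_{b_1b_2},$$ where $\rho_{ij}(\lambda,\mu)$ equals $\frac{\lambda}{\mu-\lambda}$ if $i<j$, $\frac12\,\frac{\mu+\lambda}{\mu-\lambda}$ if $i=j$, and $\frac{\mu}{\mu-\lambda}$ if $i>j$. -/

import Mathlib

open scoped TensorProduct

noncomputable section

/-! ## The `K`-linear path category of a quiver -/

section PathCategory

/-- Morphisms `a → b` of the `K`-linear category freely generated by a quiver:
formal linear combinations of paths from `a` to `b`. -/
abbrev PathHom (K : Type*) [Field K] {V : Type*} [Quiver V] (a b : V) : Type _ :=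
  Quiver.Path a b →₀ K

variable {K : Type*} [Field K] {V : Type*} [Quiver V]

/-- A path regarded as a morphism. -/
def ofPath (K : Type*) [Field K] {V : Type*} [Quiver V] {a b : V} (p : Quiver.Path a b) :
    PathHom K a b :=
  Finsupp.single p 1

/-- Concatenation `f ⊗ g ↦ f g`, with `f` traversed first. -/
def concat {a b c : V} : PathHom K a b →ₗ[K] PathHom K b c →ₗ[K] PathHom K a c :=
  Finsupp.linearCombination K fun p => Finsupp.lmapDomain K K fun q => p.comp q

/-- Concatenation as a map on the tensor product. -/
def concatTensor {a b c : V} : PathHom K a b ⊗[K] PathHom K b c →ₗ[K] PathHom K a c :=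
  TensorProduct.lift concat

@[simp]
theorem concat_ofPath {a b c : V} (p : Quiver.Path a b) (q : Quiver.Path b c) :
    concat (ofPath K p) (ofPath K q) = ofPath K (p.comp q) := by
  simp [concat, ofPath]

theorem pathHom_ext {a b : V} {M : Type*} [AddCommGroup M] [Module K M]
    {f g : PathHom K a b →ₗ[K] M} (h : ∀ p, f (ofPath K p) = g (ofPath K p)) : f = g :=
  Finsupp.lhom_ext' fun p => LinearMap.ext_ring (h p)

theorem pathHom_induction {a b : V} {P : PathHom K a b → Prop} (x : PathHom K a b)
    (h0 : P 0) (hadd : ∀ x y, P x → P y → P (x + y)) (hsmul : ∀ (r : K) x, P x → P (r • x))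
    (hp : ∀ p, P (ofPath K p)) : P x := by
  induction x using Finsupp.induction_linear with
  | zero => exact h0
  | add f g hf hg => exact hadd f g hf hg
  | single p r =>
    have := hsmul r _ (hp p)
    simpa [ofPath] using this

theorem concat_assoc {a b c d : V} (f : PathHom K a b) (g : PathHom K b c) (h : PathHom K c d) :
    concat (concat f g) h = concat f (concat g h) := by
  induction f using pathHom_induction with
  | h0 => simp
  | hadd x y hx hy => simp [hx, hy]
  | hsmul r x hx => simp [hx]
  | hp p =>
    induction g using pathHom_induction with
    | h0 => simp
    | hadd x y hx hy => simp [hx, hy]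
    | hsmul r x hx => simp [hx]
    | hp q =>
      induction h using pathHom_induction with
      | h0 => simp
      | hadd x y hx hy => simp only [map_add, hx, hy]
      | hsmul r x hx => simp only [map_smul, hx]
      | hp s => simp

/-- `x ⊗ y ↦ f x ⊗ y`, i.e. multiplication by `f ⊗ 1` from the left. -/
def mulLL {a b c d e : V} (f : PathHom K a b) :
    PathHom K b c ⊗[K] PathHom K d e →ₗ[K] PathHom K a c ⊗[K] PathHom K d e :=
  (concat f).rTensor _

/-- `x ⊗ y ↦ x ⊗ f y`, i.e. multiplication by `1 ⊗ f` from the left. -/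
def mulLR {a b c d e : V} (f : PathHom K d e) :
    PathHom K a b ⊗[K] PathHom K e c →ₗ[K] PathHom K a b ⊗[K] PathHom K d c :=
  (concat f).lTensor _

/-- `x ⊗ y ↦ x f ⊗ y`, i.e. multiplication by `f ⊗ 1` from the right. -/
def mulRL {a b c d e : V} (f : PathHom K b c) :
    PathHom K a b ⊗[K] PathHom K d e →ₗ[K] PathHom K a c ⊗[K] PathHom K d e :=
  (concat.flip f).rTensor _

/-- `x ⊗ y ↦ x ⊗ y f`, i.e. multiplication by `1 ⊗ f` from the right. -/
def mulRR {a b c d e : V} (f : PathHom K d e) :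
    PathHom K a b ⊗[K] PathHom K c d →ₗ[K] PathHom K a b ⊗[K] PathHom K c e :=
  (concat.flip f).lTensor _

/-! ### The double bracket generated by brackets of arrows -/

/-- Prescribed double brackets `{{e, f}} ∈ Hom(c,b) ⊗ Hom(a,d)` for arrows `e : a → b` and
`f : c → d`. -/
abbrev ArrowBracket (K : Type*) [Field K] (V : Type*) [Quiver V] : Type _ :=
  ∀ ⦃a b c d : V⦄, (a ⟶ b) → (c ⟶ d) → PathHom K c b ⊗[K] PathHom K a d

/-- Extension in the second argument by `{{e, g h}} = (g ⊗ 1) {{e, h}} + {{e, g}} (1 ⊗ h)`. -/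
def arrowPathBracket (β : ArrowBracket K V) {a b : V} (e : a ⟶ b) :
    {c d : V} → Quiver.Path c d → PathHom K c b ⊗[K] PathHom K a d
  | _, _, .nil => 0
  | _, _, .cons g h =>
      mulLL (ofPath K g) (β e h) + mulRR (ofPath K h.toPath) (arrowPathBracket β e g)

/-- Extension in the first argument by `{{f g, h}} = (1 ⊗ f) {{g, h}} + {{f, h}} (g ⊗ 1)`. -/
def pathPathBracket (β : ArrowBracket K V) {a : V} :
    {b c d : V} → Quiver.Path a b → Quiver.Path c d → PathHom K c b ⊗[K] PathHom K a d
  | _, _, _, .nil, _ => 0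
  | _, _, _, .cons f g, h =>
      mulLR (ofPath K f) (arrowPathBracket β g h) +
        mulRL (ofPath K g.toPath) (pathPathBracket β f h)

/-- The double bracket on the path category: the bilinear extension, obeying both double
Leibniz identities (`doubleBracket_concat_left`, `doubleBracket_concat_right`), of the
prescribed brackets of arrows. -/
def doubleBracket (β : ArrowBracket K V) {a b c d : V} :
    PathHom K a b →ₗ[K] PathHom K c d →ₗ[K] PathHom K c b ⊗[K] PathHom K a d :=
  Finsupp.linearCombination K fun p =>
    Finsupp.linearCombination K fun q => pathPathBracket β p q

@[simp]
theorem doubleBracket_ofPath (β : ArrowBracket K V) {a b c d : V}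
    (p : Quiver.Path a b) (q : Quiver.Path c d) :
    doubleBracket β (ofPath K p) (ofPath K q) = pathPathBracket β p q := by
  simp [doubleBracket, ofPath]

theorem mulLR_comp {a b c d e f : V} (x : PathHom K d e) (y : PathHom K e f)
    (t : PathHom K a b ⊗[K] PathHom K f c) : mulLR x (mulLR y t) = mulLR (concat x y) t := by
  induction t using TensorProduct.induction_on with
  | zero => simp
  | tmul u v => simp [mulLR, concat_assoc]
  | add s t hs ht => simp [hs, ht]

theorem mulRL_comp {a b c d e f : V} (x : PathHom K b c) (y : PathHom K c f)
    (t : PathHom K a b ⊗[K] PathHom K d e) : mulRL y (mulRL x t) = mulRL (concat x y) t := by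
  induction t using TensorProduct.induction_on with
  | zero => simp
  | tmul u v => simp [mulRL, concat_assoc]
  | add s t hs ht => simp [hs, ht]

theorem mulLL_comp {a b c d e f : V} (x : PathHom K f a) (y : PathHom K a b)
    (t : PathHom K b c ⊗[K] PathHom K d e) : mulLL x (mulLL y t) = mulLL (concat x y) t := by
  induction t using TensorProduct.induction_on with
  | zero => simp
  | tmul u v => simp [mulLL, concat_assoc]
  | add s t hs ht => simp [hs, ht]

theorem mulRR_comp {a b c d e f : V} (x : PathHom K d e) (y : PathHom K e f)
    (t : PathHom K a b ⊗[K] PathHom K c d) : mulRR y (mulRR x t) = mulRR (concat x y) t := by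
  induction t using TensorProduct.induction_on with
  | zero => simp
  | tmul u v => simp [mulRR, concat_assoc]
  | add s t hs ht => simp [hs, ht]

theorem mulLR_mulRL {a b c d e f : V} (x : PathHom K d e) (y : PathHom K b c)
    (t : PathHom K a b ⊗[K] PathHom K e f) : mulLR x (mulRL y t) = mulRL y (mulLR x t) := by
  induction t using TensorProduct.induction_on with
  | zero => simp
  | tmul u v => simp [mulLR, mulRL]
  | add s t hs ht => simp [hs, ht]

theorem mulLL_mulRR {a b c d e f : V} (x : PathHom K a b) (y : PathHom K e f)
    (t : PathHom K b c ⊗[K] PathHom K d e) : mulLL x (mulRR y t) = mulRR y (mulLL x t) := by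
  induction t using TensorProduct.induction_on with
  | zero => simp
  | tmul u v => simp [mulLL, mulRR]
  | add s t hs ht => simp [hs, ht]

theorem mulLR_mulLL {a b c d e f : V} (x : PathHom K d e) (y : PathHom K a b)
    (t : PathHom K b c ⊗[K] PathHom K e f) : mulLR x (mulLL y t) = mulLL y (mulLR x t) := by
  induction t using TensorProduct.induction_on with
  | zero => simp
  | tmul u v => simp [mulLL, mulLR]
  | add s t hs ht => simp [hs, ht]

theorem mulLR_mulRR {a b c d e f : V} (x : PathHom K c d) (y : PathHom K e f)
    (t : PathHom K a b ⊗[K] PathHom K d e) : mulLR x (mulRR y t) = mulRR y (mulLR x t) := by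
  induction t using TensorProduct.induction_on with
  | zero => simp
  | tmul u v => simp [mulRR, mulLR, concat_assoc]
  | add s t hs ht => simp [hs, ht]

theorem mulRL_mulLL {a b c d e f : V} (x : PathHom K c f) (y : PathHom K a b)
    (t : PathHom K b c ⊗[K] PathHom K d e) : mulRL x (mulLL y t) = mulLL y (mulRL x t) := by
  induction t using TensorProduct.induction_on with
  | zero => simp
  | tmul u v => simp [mulLL, mulRL, concat_assoc]
  | add s t hs ht => simp [hs, ht]

theorem mulRL_mulRR {a b c d e f : V} (x : PathHom K b c) (y : PathHom K e f)
    (t : PathHom K a b ⊗[K] PathHom K d e) : mulRL x (mulRR y t) = mulRR y (mulRL x t) := by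
  induction t using TensorProduct.induction_on with
  | zero => simp
  | tmul u v => simp [mulRR, mulRL]
  | add s t hs ht => simp [hs, ht]

theorem mulLR_nil {a b c d : V} (t : PathHom K a b ⊗[K] PathHom K c d) :
    mulLR (ofPath K (.nil : Quiver.Path c c)) t = t := by
  have h : (concat (ofPath K (.nil : Quiver.Path c c)) : PathHom K c d →ₗ[K] _) = .id :=
    pathHom_ext fun p => by simp
  simp [mulLR, h]

theorem mulLL_nil {a b c d : V} (t : PathHom K a b ⊗[K] PathHom K c d) :
    mulLL (ofPath K (.nil : Quiver.Path a a)) t = t := by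
  have h : (concat (ofPath K (.nil : Quiver.Path a a)) : PathHom K a b →ₗ[K] _) = .id :=
    pathHom_ext fun p => by simp
  simp [mulLL, h]

theorem mulRR_nil {a b c d : V} (t : PathHom K a b ⊗[K] PathHom K c d) :
    mulRR (ofPath K (.nil : Quiver.Path d d)) t = t := by
  have h : (concat.flip (ofPath K (.nil : Quiver.Path d d)) : PathHom K c d →ₗ[K] _) = .id :=
    pathHom_ext fun p => by simp
  simp [mulRR, h]

theorem mulRL_nil {a b c d : V} (t : PathHom K a b ⊗[K] PathHom K c d) :
    mulRL (ofPath K (.nil : Quiver.Path b b)) t = t := by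
  have h : (concat.flip (ofPath K (.nil : Quiver.Path b b)) : PathHom K a b →ₗ[K] _) = .id :=
    pathHom_ext fun p => by simp
  simp [mulRL, h]

theorem arrowPathBracket_comp (β : ArrowBracket K V) {a b : V} (e : a ⟶ b) {c d d' : V}
    (g : Quiver.Path c d) (h : Quiver.Path d d') :
    arrowPathBracket β e (g.comp h) =
      mulLL (ofPath K g) (arrowPathBracket β e h) +
        mulRR (ofPath K h) (arrowPathBracket β e g) := by
  induction h with
  | nil => simp [arrowPathBracket, mulRR_nil]
  | cons h k ih =>
    have hk : ofPath K (h.cons k) = ofPath K (h.comp k.toPath) := rfl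
    simp only [Quiver.Path.comp_cons, arrowPathBracket, ih, map_add, mulLL_comp, concat_ofPath,
      hk, mulRR_comp, mulLL_mulRR]
    abel

theorem pathPathBracket_comp_left (β : ArrowBracket K V) {a b b' c d : V}
    (f : Quiver.Path a b) (g : Quiver.Path b b') (h : Quiver.Path c d) :
    pathPathBracket β (f.comp g) h =
      mulLR (ofPath K f) (pathPathBracket β g h) +
        mulRL (ofPath K g) (pathPathBracket β f h) := by
  induction g with
  | nil => simp [pathPathBracket, mulRL_nil]
  | cons g k ih =>
    have hk : ofPath K (g.cons k) = ofPath K (g.comp k.toPath) := rfl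
    simp only [Quiver.Path.comp_cons, pathPathBracket, ih, map_add, mulLR_comp, concat_ofPath,
      hk, mulRL_comp, mulLR_mulRL]
    abel

theorem pathPathBracket_comp_right (β : ArrowBracket K V) {a b c d d' : V}
    (f : Quiver.Path a b) (g : Quiver.Path c d) (h : Quiver.Path d d') :
    pathPathBracket β f (g.comp h) =
      mulLL (ofPath K g) (pathPathBracket β f h) +
        mulRR (ofPath K h) (pathPathBracket β f g) := by
  induction f with
  | nil => simp [pathPathBracket]
  | cons f k ih =>
    simp only [pathPathBracket, ih, arrowPathBracket_comp, map_add, mulLR_mulLL, mulLR_mulRR,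
      mulRL_mulLL, mulRL_mulRR]
    abel

/-- First double Leibniz identity. -/
theorem doubleBracket_concat_left (β : ArrowBracket K V) {a b b' c d : V}
    (f : PathHom K a b) (g : PathHom K b b') (h : PathHom K c d) :
    doubleBracket β (concat f g) h =
      mulLR f (doubleBracket β g h) + mulRL g (doubleBracket β f h) := by
  induction h using pathHom_induction with
  | h0 => simp
  | hadd x y hx hy => simp only [map_add, hx, hy]; abel
  | hsmul r x hx => simp only [map_smul, hx, smul_add]
  | hp h =>
    induction f using pathHom_induction with
    | h0 => simp [mulLR]
    | hadd x y hx hy =>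
      simp only [map_add, LinearMap.add_apply, hx, hy, mulLR, LinearMap.lTensor_add]; abel
    | hsmul r x hx =>
      simp only [map_smul, LinearMap.smul_apply, hx, smul_add, mulLR, LinearMap.lTensor_smul]
    | hp f =>
      induction g using pathHom_induction with
      | h0 => simp [mulRL]
      | hadd x y hx hy =>
        simp only [map_add, LinearMap.add_apply, hx, hy, mulRL, LinearMap.rTensor_add]; abel
      | hsmul r x hx =>
        simp only [map_smul, LinearMap.smul_apply, hx, smul_add, mulRL, LinearMap.rTensor_smul]
      | hp g => simp [pathPathBracket_comp_left]

/-- Second double Leibniz identity. -/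
theorem doubleBracket_concat_right (β : ArrowBracket K V) {a b c d d' : V}
    (f : PathHom K a b) (g : PathHom K c d) (h : PathHom K d d') :
    doubleBracket β f (concat g h) =
      mulLL g (doubleBracket β f h) + mulRR h (doubleBracket β f g) := by
  induction f using pathHom_induction with
  | h0 => simp
  | hadd x y hx hy => simp only [map_add, LinearMap.add_apply, hx, hy]; abel
  | hsmul r x hx => simp only [map_smul, LinearMap.smul_apply, hx, smul_add]
  | hp f =>
    induction g using pathHom_induction with
    | h0 => simp [mulLL]
    | hadd x y hx hy =>
      simp only [map_add, LinearMap.add_apply, hx, hy, mulLL, LinearMap.rTensor_add]; abel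
    | hsmul r x hx =>
      simp only [map_smul, LinearMap.smul_apply, hx, smul_add, mulLL, LinearMap.rTensor_smul]
    | hp g =>
      induction h using pathHom_induction with
      | h0 => simp [mulRR]
      | hadd x y hx hy =>
        simp only [map_add, LinearMap.add_apply, hx, hy, mulRR, LinearMap.lTensor_add]; abel
      | hsmul r x hx =>
        simp only [map_smul, LinearMap.smul_apply, hx, smul_add, mulRR, LinearMap.lTensor_smul]
      | hp h => simp [pathPathBracket_comp_right]

/-- The induced bracket `{f, h}`: concatenation applied to `{{f, h}}`, for a loop `f`. -/
def loopBracket (β : ArrowBracket K V) {a c d : V} :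
    PathHom K a a →ₗ[K] PathHom K c d →ₗ[K] PathHom K c d :=
  (doubleBracket β).compr₂ concatTensor

theorem concatTensor_mulLR {a b c d : V} (f : PathHom K b a)
    (t : PathHom K c b ⊗[K] PathHom K a d) :
    concatTensor (mulLR f t) = concatTensor (mulRL f t) := by
  induction t using TensorProduct.induction_on with
  | zero => simp
  | tmul u v => simp [mulLR, mulRL, concatTensor, concat_assoc]
  | add s t hs ht => simp [hs, ht]

theorem concatTensor_mulLL {a b c d : V} (f : PathHom K a b)
    (t : PathHom K b c ⊗[K] PathHom K c d) :
    concatTensor (mulLL f t) = concat f (concatTensor t) := by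
  induction t using TensorProduct.induction_on with
  | zero => simp
  | tmul u v => simp [mulLL, concatTensor, concat_assoc]
  | add s t hs ht => simp [hs, ht]

theorem concatTensor_mulRR {a b c d : V} (f : PathHom K c d)
    (t : PathHom K a b ⊗[K] PathHom K b c) :
    concatTensor (mulRR f t) = concat (concatTensor t) f := by
  induction t using TensorProduct.induction_on with
  | zero => simp
  | tmul u v => simp [mulRR, concatTensor, concat_assoc]
  | add s t hs ht => simp [hs, ht]

theorem loopBracket_cyclic (β : ArrowBracket K V) {a b c d : V}
    (f : PathHom K a b) (g : PathHom K b a) (h : PathHom K c d) :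
    loopBracket β (concat f g) h = loopBracket β (concat g f) h := by
  simp only [loopBracket, LinearMap.compr₂_apply, doubleBracket_concat_left, map_add,
    concatTensor_mulLR]
  abel

theorem loopBracket_concat (β : ArrowBracket K V) {a c d d' : V}
    (f : PathHom K a a) (g : PathHom K c d) (h : PathHom K d d') :
    loopBracket β f (concat g h) =
      concat g (loopBracket β f h) + concat (loopBracket β f g) h := by
  simp only [loopBracket, LinearMap.compr₂_apply, doubleBracket_concat_right, map_add,
    concatTensor_mulLL, concatTensor_mulRR]

end PathCategory

/-! ## The full subcategory on chosen objects: cyclic space, ideals, completion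

`obj : ι → V` selects the objects of a full subcategory `C` of the path category. -/

section Completion

variable {K : Type*} [Field K] {V : Type*} [Quiver V] {ι : Type*} (obj : ι → V)

/-- A linear combination of loops of `C` based at `i`, in the span of all loops. -/
def loopSpan (i : ι) : PathHom K (obj i) (obj i) →ₗ[K]
    ((Σ i, Quiver.Path (obj i) (obj i)) →₀ K) :=
  Finsupp.lmapDomain K K fun p => ⟨i, p⟩

/-- The span of all `f g - g f`, for `f g` a loop of `C`. -/
def commutators (K : Type*) [Field K] :
    Submodule K ((Σ i, Quiver.Path (obj i) (obj i)) →₀ K) :=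
  Submodule.span K {x | ∃ (i j : ι) (f : PathHom K (obj i) (obj j))
    (g : PathHom K (obj j) (obj i)),
    x = loopSpan obj i (concat f g) - loopSpan obj j (concat g f)}

/-- The cyclic space of `C`: linear combinations of loops modulo commutators. -/
def CyclicSpace (K : Type*) [Field K] : Type _ :=
  ((Σ i, Quiver.Path (obj i) (obj i)) →₀ K) ⧸ commutators obj K

instance : AddCommGroup (CyclicSpace obj K) :=
  inferInstanceAs (AddCommGroup (_ ⧸ commutators obj K))

instance : Module K (CyclicSpace obj K) :=
  inferInstanceAs (Module K (_ ⧸ commutators obj K))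

/-- The quotient map to the cyclic space. -/
def cycMk (K : Type*) [Field K] :
    ((Σ i, Quiver.Path (obj i) (obj i)) →₀ K) →ₗ[K] CyclicSpace obj K :=
  (commutators obj K).mkQ

theorem cycMk_surjective (K : Type*) [Field K] : Function.Surjective (cycMk obj K) :=
  Submodule.mkQ_surjective _

/-- The class of a loop in the cyclic space. -/
def cyc (i : ι) : PathHom K (obj i) (obj i) →ₗ[K] CyclicSpace obj K :=
  cycMk obj K ∘ₗ loopSpan obj i

theorem linearCombination_loopSpan (β : ArrowBracket K V) (c d i : ι)
    (f : PathHom K (obj i) (obj i)) :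
    Finsupp.linearCombination K (fun p : Σ i, Quiver.Path (obj i) (obj i) =>
      (loopBracket β (ofPath K p.2) : PathHom K (obj c) (obj d) →ₗ[K] _)) (loopSpan obj i f) =
      loopBracket β f := by
  induction f using pathHom_induction with
  | h0 => simp
  | hadd x y hx hy => simp only [map_add, hx, hy]
  | hsmul r x hx => simp only [map_smul, hx]
  | hp p => simp [loopSpan, ofPath]

/-- The bracket `{-,-}` of the cyclic space with `C`, induced by the double bracket. -/
def cyclicBracket (β : ArrowBracket K V) (c d : ι) :
    CyclicSpace obj K →ₗ[K]
      PathHom K (obj c) (obj d) →ₗ[K] PathHom K (obj c) (obj d) :=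
  (commutators obj K).liftQ
    (Finsupp.linearCombination K fun p => loopBracket β (ofPath K p.2)) <| by
    rw [commutators, Submodule.span_le]
    rintro _ ⟨i, j, f, g, rfl⟩
    simp only [SetLike.mem_coe, LinearMap.mem_ker, map_sub, linearCombination_loopSpan]
    rw [sub_eq_zero]
    exact LinearMap.ext fun h => loopBracket_cyclic β f g h

theorem cyclicBracket_cyc (β : ArrowBracket K V) (c d i : ι)
    (f : PathHom K (obj i) (obj i)) :
    cyclicBracket obj β c d (cyc obj i f) = loopBracket β f :=
  linearCombination_loopSpan obj β c d i f

/-- A two-sided ideal of the `K`-linear category `C`. -/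
structure PathIdeal (K : Type*) [Field K] {V : Type*} [Quiver V] {ι : Type*} (obj : ι → V) where
  /-- The morphisms belonging to the ideal. -/
  carrier : ∀ i j : ι, Submodule K (PathHom K (obj i) (obj j))
  concat_left_mem : ∀ {i j k : ι} (f : PathHom K (obj i) (obj j)) {g : PathHom K (obj j) (obj k)},
    g ∈ carrier j k → concat f g ∈ carrier i k
  concat_right_mem : ∀ {i j k : ι} {f : PathHom K (obj i) (obj j)}
    (g : PathHom K (obj j) (obj k)), f ∈ carrier i j → concat f g ∈ carrier i k

namespace PathIdeal

variable {obj} (J : PathIdeal K obj)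

/-- The powers `J ^ m` of an ideal, with `J ^ 0` the whole category. -/
def pow : ℕ → ∀ i j : ι, Submodule K (PathHom K (obj i) (obj j))
  | 0, _, _ => ⊤
  | m + 1, i, j => Submodule.span K {x | ∃ (k : ι), ∃ f ∈ J.carrier i k,
      ∃ g ∈ pow m k j, x = concat f g}

theorem concat_mem_pow_succ {m : ℕ} {i j k : ι} {f : PathHom K (obj i) (obj j)}
    {g : PathHom K (obj j) (obj k)} (hf : f ∈ J.carrier i j) (hg : g ∈ J.pow m j k) :
    concat f g ∈ J.pow (m + 1) i k :=
  Submodule.subset_span ⟨j, f, hf, g, hg, rfl⟩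

theorem pow_induction {m : ℕ} {i j : ι} {P : PathHom K (obj i) (obj j) → Prop}
    {x : PathHom K (obj i) (obj j)} (hx : x ∈ J.pow (m + 1) i j)
    (h : ∀ (k : ι), ∀ f ∈ J.carrier i k, ∀ g ∈ J.pow m k j, P (concat f g))
    (h0 : P 0) (hadd : ∀ x y, P x → P y → P (x + y))
    (hsmul : ∀ (r : K) x, P x → P (r • x)) : P x := by
  refine Submodule.span_induction (p := fun x _ => P x) ?_ h0 (fun x y _ _ => hadd x y)
    (fun r x _ => hsmul r x) hx
  rintro _ ⟨k, f, hf, g, hg, rfl⟩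
  exact h k f hf g hg

theorem pow_concat_left {m : ℕ} {i j k : ι} (f : PathHom K (obj i) (obj j))
    {g : PathHom K (obj j) (obj k)} (hg : g ∈ J.pow m j k) : concat f g ∈ J.pow m i k := by
  cases m with
  | zero => trivial
  | succ m =>
    refine J.pow_induction (P := fun y => concat f y ∈ J.pow (m + 1) i k) hg ?_ (by simp) (fun x y hx hy => ?_) (fun r x hx => ?_)
    · intro l u hu v hv
      rw [← concat_assoc]
      exact J.concat_mem_pow_succ (J.concat_left_mem f hu) hv
    · rw [map_add]; exact add_mem hx hy
    · rw [map_smul]; exact Submodule.smul_mem _ _ hx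

theorem pow_mul_pow {m n : ℕ} {i j k : ι} {f : PathHom K (obj i) (obj j)}
    {g : PathHom K (obj j) (obj k)} (hf : f ∈ J.pow m i j) (hg : g ∈ J.pow n j k) :
    concat f g ∈ J.pow (m + n) i k := by
  induction m generalizing i with
  | zero => simpa using J.pow_concat_left f hg
  | succ m ih =>
    refine J.pow_induction (P := fun x => concat x g ∈ J.pow (m + 1 + n) i k) hf ?_ (by simp)
      (fun x y hx hy => ?_) (fun r x hx => ?_)
    · intro l u hu v hv
      rw [concat_assoc, Nat.succ_add]
      exact J.concat_mem_pow_succ hu (ih hv)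
    · rw [map_add, LinearMap.add_apply]; exact add_mem hx hy
    · rw [map_smul, LinearMap.smul_apply]; exact Submodule.smul_mem _ _ hx

theorem pow_concat_right {m : ℕ} {i j k : ι} {f : PathHom K (obj i) (obj j)}
    (g : PathHom K (obj j) (obj k)) (hf : f ∈ J.pow m i j) : concat f g ∈ J.pow m i k :=
  J.pow_mul_pow (n := 0) hf trivial

theorem pow_succ_le (m : ℕ) (i j : ι) : J.pow (m + 1) i j ≤ J.pow m i j := by
  intro x hx
  refine J.pow_induction hx ?_ (zero_mem _) (fun _ _ => add_mem)
    (fun r _ => Submodule.smul_mem _ r)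
  intro k f _ g hg
  exact J.pow_concat_left f hg

theorem pow_antitone {m n : ℕ} (h : m ≤ n) (i j : ι) : J.pow n i j ≤ J.pow m i j := by
  induction h with
  | refl => exact le_rfl
  | step _ ih => exact (J.pow_succ_le _ i j).trans ih

/-- The filtration of `C ⊗ C` by total degree. -/
def tensorPow (m : ℕ) (i j k l : ι) :
    Submodule K (PathHom K (obj i) (obj j) ⊗[K] PathHom K (obj k) (obj l)) :=
  Submodule.span K {t | ∃ p q, m ≤ p + q ∧ ∃ x ∈ J.pow p i j, ∃ y ∈ J.pow q k l, t = x ⊗ₜ[K] y}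

theorem doubleBracket_mem_tensorPow (β : ArrowBracket K V) {m : ℕ} {i j k l : ι}
    {f : PathHom K (obj i) (obj j)} (hf : f ∈ J.pow (m + 1) i j)
    (h : PathHom K (obj k) (obj l)) : doubleBracket β f h ∈ J.tensorPow m k j i l := by
  induction m generalizing i with
  | zero =>
    refine (?_ : J.tensorPow 0 k j i l = ⊤) ▸ Submodule.mem_top
    rw [eq_top_iff, ← TensorProduct.span_tmul_eq_top]
    refine Submodule.span_mono ?_
    rintro _ ⟨x, y, rfl⟩
    exact ⟨0, 0, le_rfl, x, trivial, y, trivial, rfl⟩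
  | succ m ih =>
    refine J.pow_induction (P := fun x => doubleBracket β x h ∈ J.tensorPow (m + 1) k j i l) hf ?_
      (by simp) (fun x y hx hy => ?_) (fun r x hx => ?_)
    · intro n u hu v hv
      rw [doubleBracket_concat_left]
      refine add_mem ?_ ?_
      · refine Submodule.span_induction (p := fun t _ => mulLR u t ∈ J.tensorPow (m + 1) k j i l)
          ?_ (by simp) (fun x y _ _ hx hy => ?_) (fun r x _ hx => ?_) (ih hv)
        · rintro _ ⟨p, q, hpq, x, hx, y, hy, rfl⟩
          exact Submodule.subset_span
            ⟨p, q + 1, by omega, x, hx, concat u y, J.concat_mem_pow_succ hu hy, rfl⟩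
        · rw [map_add]; exact add_mem hx hy
        · rw [map_smul]; exact Submodule.smul_mem _ _ hx
      · induction doubleBracket β u h using TensorProduct.induction_on with
        | zero => simp
        | add s t hs ht => rw [map_add]; exact add_mem hs ht
        | tmul x y =>
          exact Submodule.subset_span
            ⟨m + 1, 0, le_rfl, concat x v, J.pow_concat_left x hv, y, trivial, rfl⟩
    · rw [map_add, LinearMap.add_apply]; exact add_mem hx hy
    · rw [map_smul, LinearMap.smul_apply]; exact Submodule.smul_mem _ _ hx

theorem loopBracket_mem_left (β : ArrowBracket K V) {m : ℕ} {i k l : ι}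
    {f : PathHom K (obj i) (obj i)} (hf : f ∈ J.pow (m + 1) i i)
    (h : PathHom K (obj k) (obj l)) : loopBracket β f h ∈ J.pow m k l := by
  rw [loopBracket, LinearMap.compr₂_apply]
  refine Submodule.span_induction (p := fun t _ => concatTensor t ∈ J.pow m k l)
    ?_ (by simp) (fun x y _ _ hx hy => ?_) (fun r x _ hx => ?_)
    (J.doubleBracket_mem_tensorPow β hf h)
  · rintro _ ⟨p, q, hpq, x, hx, y, hy, rfl⟩
    exact J.pow_antitone hpq _ _ (J.pow_mul_pow hx hy)
  · rw [map_add]; exact add_mem hx hy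
  · rw [map_smul]; exact Submodule.smul_mem _ _ hx

theorem loopBracket_mem_right (β : ArrowBracket K V) {m : ℕ} {i k l : ι}
    (f : PathHom K (obj i) (obj i)) {h : PathHom K (obj k) (obj l)}
    (hh : h ∈ J.pow (m + 1) k l) : loopBracket β f h ∈ J.pow m k l := by
  induction m generalizing k with
  | zero => trivial
  | succ m ih =>
    refine J.pow_induction (P := fun y => loopBracket β f y ∈ J.pow (m + 1) k l) hh ?_ (by simp)
      (fun x y hx hy => ?_) (fun r x hx => ?_)
    · intro n u hu v hv
      rw [loopBracket_concat]
      exact add_mem (J.concat_mem_pow_succ hu (ih hv)) (J.pow_concat_left _ hv)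
    · rw [map_add]; exact add_mem hx hy
    · rw [map_smul]; exact Submodule.smul_mem _ _ hx

/-! ### The completed category -/

/-- `Hom(i,j)` in the completed category `Ĉ`: the inverse limit of `Hom(i,j) / J^m(i,j)`. When `C`
is graded with `J^m` the span of the homogeneous elements of degree at least `m`, this is the
product of the homogeneous components, i.e. the space of formal power series. -/
def completion (i j : ι) : Submodule K (∀ m : ℕ, PathHom K (obj i) (obj j) ⧸ J.pow m i j) where
  carrier := {x | ∀ m, Submodule.factor (J.pow_succ_le m i j) (x (m + 1)) = x m}
  add_mem' hx hy m := by simp [hx m, hy m]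
  zero_mem' m := by simp
  smul_mem' r x hx m := by simp [hx m]

instance (i j : ι) : AddCommGroup (J.completion i j) := Module.addCommMonoidToAddCommGroup K

/-- The canonical map `C → Ĉ`. -/
def toCompletion (i j : ι) : PathHom K (obj i) (obj j) →ₗ[K] J.completion i j where
  toFun f := ⟨fun m => (J.pow m i j).mkQ f, fun m => by simp⟩
  map_add' f g := rfl
  map_smul' r f := rfl

/-- Concatenation modulo `J ^ m`. -/
def concatMod (m : ℕ) (i j k : ι) :
    (PathHom K (obj i) (obj j) ⧸ J.pow m i j) →ₗ[K]
      (PathHom K (obj j) (obj k) ⧸ J.pow m j k) →ₗ[K]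
        (PathHom K (obj i) (obj k) ⧸ J.pow m i k) :=
  (J.pow m i j).liftQ
    (LinearMap.flip <| (J.pow m j k).liftQ (concat.compr₂ (J.pow m i k).mkQ).flip <| by
      intro g hg
      refine LinearMap.mem_ker.2 (LinearMap.ext fun f => ?_)
      simpa using J.pow_concat_left f hg) <| by
    intro f hf
    refine LinearMap.mem_ker.2 (LinearMap.ext fun g => ?_)
    obtain ⟨g, rfl⟩ := Submodule.mkQ_surjective _ g
    simpa using J.pow_concat_right g hf

theorem concatMod_mk (m : ℕ) (i j k : ι) (f : PathHom K (obj i) (obj j))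
    (g : PathHom K (obj j) (obj k)) :
    J.concatMod m i j k ((J.pow m i j).mkQ f) ((J.pow m j k).mkQ g) =
      (J.pow m i k).mkQ (concat f g) := rfl

/-- Concatenation in `Ĉ`. -/
def hatConcat {i j k : ι} (x : J.completion i j) (y : J.completion j k) : J.completion i k :=
  ⟨fun m => J.concatMod m i j k (x.1 m) (y.1 m), fun m => by
    beta_reduce
    rw [← x.2 m, ← y.2 m]
    obtain ⟨f, hf⟩ := Submodule.mkQ_surjective _ (x.1 (m + 1))
    obtain ⟨g, hg⟩ := Submodule.mkQ_surjective _ (y.1 (m + 1))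
    rw [← hf, ← hg]
    rfl⟩

/-- The filtration of the cyclic space by the classes of loops in `J ^ m`. -/
def cyclicPow (m : ℕ) : Submodule K (CyclicSpace obj K) :=
  ⨆ i, (J.pow m i i).map (cyc obj i)

theorem cyclicPow_succ_le (m : ℕ) : J.cyclicPow (m + 1) ≤ J.cyclicPow m :=
  iSup_mono fun i => Submodule.map_mono (J.pow_succ_le m i i)

/-- The completed cyclic space. -/
def cyclicCompletion :
    Submodule K (∀ m : ℕ, CyclicSpace obj K ⧸ J.cyclicPow m) where
  carrier := {x | ∀ m, Submodule.factor (J.cyclicPow_succ_le m) (x (m + 1)) = x m}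
  add_mem' hx hy m := by simp [hx m, hy m]
  zero_mem' m := by simp
  smul_mem' r x hx m := by simp [hx m]

/-- The class in the completed cyclic space of a loop of `Ĉ`. -/
def hatCyc (i : ι) (x : J.completion i i) : J.cyclicCompletion :=
  ⟨fun m => (J.pow m i i).mapQ (J.cyclicPow m) (cyc obj i)
      (Submodule.map_le_iff_le_comap.1 (le_iSup (fun i => (J.pow m i i).map (cyc obj i)) i))
      (x.1 m), fun m => by
    beta_reduce
    rw [← x.2 m]
    obtain ⟨f, hf⟩ := Submodule.mkQ_surjective _ (x.1 (m + 1))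
    rw [← hf]
    rfl⟩

theorem cyclicBracket_mem_left (β : ArrowBracket K V) {m : ℕ} {k l : ι}
    {x : CyclicSpace obj K} (hx : x ∈ J.cyclicPow (m + 1)) (h : PathHom K (obj k) (obj l)) :
    cyclicBracket obj β k l x h ∈ J.pow m k l := by
  have : J.cyclicPow (m + 1) ≤
      (J.pow m k l).comap ((cyclicBracket obj β k l).flip h) := by
    refine iSup_le fun i => ?_
    rw [Submodule.map_le_iff_le_comap]
    intro f hf
    simpa [cyclicBracket_cyc] using J.loopBracket_mem_left β hf h
  exact this hx

theorem cyclicBracket_mem_right (β : ArrowBracket K V) {m : ℕ} {k l : ι}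
    (x : CyclicSpace obj K) {h : PathHom K (obj k) (obj l)} (hh : h ∈ J.pow (m + 1) k l) :
    cyclicBracket obj β k l x h ∈ J.pow m k l := by
  obtain ⟨x, rfl⟩ := cycMk_surjective obj K x
  induction x using Finsupp.induction_linear with
  | zero => simp
  | add x y hx hy => rw [map_add, map_add, LinearMap.add_apply]; exact add_mem hx hy
  | single p r =>
    have h1 : cycMk obj K (Finsupp.single p r) = r • cyc obj p.1 (ofPath K p.2) := by
      rw [cyc, LinearMap.comp_apply, ← map_smul]
      simp [loopSpan, ofPath]
    rw [h1, map_smul, LinearMap.smul_apply, cyclicBracket_cyc]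
    exact Submodule.smul_mem _ _ (J.loopBracket_mem_right β _ hh)

/-- The bracket lowers the filtration by at most one, hence descends to a map from classes
modulo `J ^ (m + 1)` to classes modulo `J ^ m`. -/
def bracketMod (β : ArrowBracket K V) (m : ℕ) (k l : ι) :
    (CyclicSpace obj K ⧸ J.cyclicPow (m + 1)) →ₗ[K]
      (PathHom K (obj k) (obj l) ⧸ J.pow (m + 1) k l) →ₗ[K]
        (PathHom K (obj k) (obj l) ⧸ J.pow m k l) :=
  (J.cyclicPow (m + 1)).liftQ
    (LinearMap.flip <| (J.pow (m + 1) k l).liftQ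
      ((cyclicBracket obj β k l).compr₂ (J.pow m k l).mkQ).flip <| by
      intro h hh
      refine LinearMap.mem_ker.2 (LinearMap.ext fun x => ?_)
      simpa using J.cyclicBracket_mem_right β x hh) <| by
    intro x hx
    refine LinearMap.mem_ker.2 (LinearMap.ext fun h => ?_)
    obtain ⟨h, rfl⟩ := Submodule.mkQ_surjective _ h
    simpa using J.cyclicBracket_mem_left β hx h

/-- The bracket `{-,-}` of the completed cyclic space with `Ĉ`: the continuous extension of
`cyclicBracket`. -/
def hatBracket (β : ArrowBracket K V) {k l : ι}
    (x : J.cyclicCompletion) (y : J.completion k l) : J.completion k l :=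
  ⟨fun m => J.bracketMod β m k l (x.1 (m + 1)) (y.1 (m + 1)), fun m => by
    beta_reduce
    rw [← x.2 (m + 1), ← y.2 (m + 1)]
    obtain ⟨f, hf⟩ := Submodule.mkQ_surjective _ (x.1 (m + 1 + 1))
    obtain ⟨g, hg⟩ := Submodule.mkQ_surjective _ (y.1 (m + 1 + 1))
    rw [← hf, ← hg]
    rfl⟩

end PathIdeal

/-! ### Matrices -/

/-- Square matrices over `C`, with `(i,j)` entry in `Hom(i,j)`. -/
abbrev PathMatrix (K : Type*) [Field K] {V : Type*} [Quiver V] {ι : Type*} (obj : ι → V) : Type _ :=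
  ∀ i j : ι, PathHom K (obj i) (obj j)

/-- The identity matrix: identity morphisms on the diagonal, zero elsewhere. -/
def identityMatrix (K : Type*) [Field K] [DecidableEq ι] : PathMatrix K obj := fun i j =>
  if h : i = j then h ▸ ofPath K (.nil : Quiver.Path (obj i) (obj i)) else 0

variable {obj} [Fintype ι]

/-- Powers of a matrix over `C`. -/
def matrixPow [DecidableEq ι] (X : PathMatrix K obj) : ℕ → PathMatrix K obj
  | 0 => identityMatrix obj K
  | n + 1 => fun i j => ∑ k, concat (X i k) (matrixPow X n k j)

namespace PathIdeal

variable (J : PathIdeal K obj)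

theorem matrixPow_mem [DecidableEq ι] {X : PathMatrix K obj} (hX : ∀ i j, X i j ∈ J.carrier i j)
    (n : ℕ) (i j : ι) : matrixPow X n i j ∈ J.pow n i j := by
  induction n generalizing i j with
  | zero => trivial
  | succ n ih => exact Submodule.sum_mem _ fun k _ => J.concat_mem_pow_succ (hX i k) (ih k j)

/-- Square matrices over `Ĉ`. -/
abbrev HatMatrix : Type _ := ∀ i j : ι, J.completion i j

/-- Product of matrices over `Ĉ`. -/
def hatMul (A B : J.HatMatrix) : J.HatMatrix := fun i j => ∑ k, J.hatConcat (A i k) (B k j)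

/-- The sum `∑ cₙ Xⁿ` in the completed category, for a matrix `X` with entries in `J`: its image
modulo `J ^ m` is `∑_{n < m} cₙ Xⁿ`, as `Xⁿ` vanishes modulo `J ^ m` for `n ≥ m`. -/
def powerSeries [DecidableEq ι] (coeff : ℕ → K) (X : PathMatrix K obj)
    (hX : ∀ i j, X i j ∈ J.carrier i j) : J.HatMatrix := fun i j =>
  ⟨fun m => (J.pow m i j).mkQ (∑ n ∈ Finset.range m, coeff n • matrixPow X n i j), fun m => by
    beta_reduce
    rw [Submodule.factor_mk, Finset.sum_range_succ, map_add,
      add_eq_left, Submodule.mkQ_apply, Submodule.Quotient.mk_eq_zero]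
    exact Submodule.smul_mem _ _ (J.matrixPow_mem hX m i j)⟩

/-- The logarithm `log B = log (1 + X) = ∑_{n ≥ 1} (-1)^(n+1) Xⁿ / n` of a matrix `1 + X` with the entries
of `X` in `J`. -/
def logOneAdd [DecidableEq ι] (X : PathMatrix K obj) (hX : ∀ i j, X i j ∈ J.carrier i j) :
    J.HatMatrix :=
  J.powerSeries (fun n => if n = 0 then 0 else (-1) ^ (n + 1) / (n : K)) X hX

/-- The class of the trace of a matrix in the completed cyclic space. -/
def hatTrace (A : J.HatMatrix) : J.cyclicCompletion := ∑ i, J.hatCyc i (A i i)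

end PathIdeal

end Completion

/-! ## Perfect networks on a cylinder -/

/-- A finite perfect directed graph with `m` univalent sources and `n` univalent sinks, whose
internal vertices are trivalent, each being white (one incoming and two outgoing edges) or black
(two incoming and one outgoing edge), together with a cyclic order of the edges at each
internal vertex. Every edge starts at exactly one outgoing half-edge and ends at exactly one incoming
half-edge. At a white vertex `w` the outgoing half-edges `(w, false)`, `(w, true)` and the
incoming one are in counter-clockwise order; at a black vertex `b` the incoming half-edges
`(b, false)`, `(b, true)` and the outgoing one are in counter-clockwise order. -/
structure PerfectNetwork (m n : ℕ) where
  White : Type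
  Black : Type
  Edge : Type
  [fintypeWhite : Fintype White]
  [fintypeBlack : Fintype Black]
  [fintypeEdge : Fintype Edge]
  /-- The half-edge at which an edge starts: a source, one of the two outgoing half-edges of a
  white vertex, or the outgoing half-edge of a black vertex. -/
  start : Edge ≃ Fin m ⊕ (White × Bool) ⊕ Black
  /-- The half-edge at which an edge ends: a sink, the incoming half-edge of a white vertex, or one
  of the two incoming half-edges of a black vertex. -/
  finish : Edge ≃ Fin n ⊕ White ⊕ (Black × Bool)

attribute [instance] PerfectNetwork.fintypeWhite PerfectNetwork.fintypeBlack
  PerfectNetwork.fintypeEdge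

namespace PerfectNetwork

variable {m n : ℕ} (Γ : PerfectNetwork m n)

/-- The vertices: sources, internal vertices, sinks. -/
inductive Vertex : Type
  | source (i : Fin m)
  | white (w : Γ.White)
  | black (b : Γ.Black)
  | sink (j : Fin n)

/-- The vertex at which an edge starts. -/
def src (e : Γ.Edge) : Γ.Vertex :=
  match Γ.start e with
  | .inl i => .source i
  | .inr (.inl (w, _)) => .white w
  | .inr (.inr b) => .black b

/-- The vertex at which an edge ends. -/
def tgt (e : Γ.Edge) : Γ.Vertex :=
  match Γ.finish e with
  | .inl j => .sink j
  | .inr (.inl w) => .white w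
  | .inr (.inr (b, _)) => .black b

instance : Quiver Γ.Vertex := ⟨fun u v => {e : Γ.Edge // Γ.src e = u ∧ Γ.tgt e = v}⟩

/-- There are no oriented cycles. -/
def IsAcyclic : Prop := ∀ (v : Γ.Vertex) (p : Quiver.Path v v), p.length = 0

/-- The ends of edges: `inl e` is the initial and `inr e` the terminal end of `e`. -/
abbrev Dart : Type := Γ.Edge ⊕ Γ.Edge

/-- Draw the cylinder as a rectangle with top and bottom identified, the sources numbered
from top to bottom on the left edge and the sinks from top to bottom on the right edge, and
contract either boundary circle to a point, so that the graph lies on a sphere. `rotate` sends an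
end of an edge to the next one in counter-clockwise order around its vertex of that
spherical graph. -/
def rotate : Γ.Dart → Γ.Dart
  | .inl e => match Γ.start e with
    | .inl i => .inl (Γ.start.symm (.inl ((finRotate m).symm i)))
    | .inr (.inl (w, false)) => .inl (Γ.start.symm (.inr (.inl (w, true))))
    | .inr (.inl (w, true)) => .inr (Γ.finish.symm (.inr (.inl w)))
    | .inr (.inr b) => .inr (Γ.finish.symm (.inr (.inr (b, false))))
  | .inr e => match Γ.finish e with
    | .inl j => .inr (Γ.finish.symm (.inl (finRotate n j)))
    | .inr (.inl w) => .inl (Γ.start.symm (.inr (.inl (w, false))))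
    | .inr (.inr (b, false)) => .inr (Γ.finish.symm (.inr (.inr (b, true))))
    | .inr (.inr (b, true)) => .inl (Γ.start.symm (.inr (.inr b)))

/-- One step of the walk around a face of the spherical graph: traverse the edge, then take the
next edge in counter-clockwise order at the vertex reached. -/
def faceStep (d : Γ.Dart) : Γ.Dart := Γ.rotate d.swap

/-- The faces of the spherical graph: the orbits of `faceStep`. -/
abbrev Face : Type := Quot fun d d' : Γ.Dart => Γ.faceStep d = d'

/-- The graph is embedded in the cylinder with the given cyclic orders at the internal vertices,
the sources in the given order on one boundary circle and the sinks in the given order on the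
other: the spherical graph satisfies Euler's formula `V - E + F = 2`. (For an acyclic network with
sources and sinks, the spherical graph is connected.) -/
def IsCylindrical : Prop :=
  Fintype.card Γ.White + Fintype.card Γ.Black + 2 + Nat.card Γ.Face = Fintype.card Γ.Edge + 2

variable {Γ} in
/-- The oriented intersection number with the cut of the step from `d` to `faceStep d`. The
first part of the step follows an edge. The second part crosses the cut only if it runs along a
boundary circle past an endpoint of the cut: downwards from the last to the first
sink, or upwards from the first to the last source. -/
def stepCrossing (cross : Γ.Edge → ℤ) : Γ.Dart → ℤ
  | .inl e => cross e + match Γ.finish e with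
    | .inl j => if (j : ℕ) + 1 = n then -1 else 0
    | .inr _ => 0
  | .inr e => -cross e + match Γ.start e with
    | .inl i => if (i : ℕ) = 0 then 1 else 0
    | .inr _ => 0

open Classical in
/-- `cross e` is the oriented intersection number of the edge `e` with a cut, i.e. a curve from
the left to the right boundary circle with its endpoints between the last and the first
source, and between the last and the first sink: edges crossing the cut upwards count `+1`. These
are the functions for which the total intersection number with the boundary of every face is `0`. -/
def IsCut (cross : Γ.Edge → ℤ) : Prop :=
  ∀ F : Γ.Face, ∑ d : Γ.Dart with Quot.mk _ d = F, stepCrossing cross d = 0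

end PerfectNetwork

/-- An acyclic perfect network on a cylinder, with all sources on one boundary circle and all sinks on
the other, and with a chosen cut. -/
structure CylindricalNetwork (m n : ℕ) extends PerfectNetwork m n where
  acyclic : toPerfectNetwork.IsAcyclic
  cylindrical : toPerfectNetwork.IsCylindrical
  /-- The oriented intersection number of an edge with the cut. -/
  cross : Edge → ℤ
  isCut : toPerfectNetwork.IsCut cross

namespace CylindricalNetwork

/-! ### The torus network and its double bracket -/

/-- Vertices of the torus network obtained by gluing the `i`-th sink to the `i`-th source. -/
inductive TorusVertex {N : ℕ} (Γ : CylindricalNetwork N N) : Type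
  | marked (i : Fin N)
  | white (w : Γ.White)
  | black (b : Γ.Black)

variable {N : ℕ} (Γ : CylindricalNetwork N N)

/-- The gluing map on vertices. -/
def glueVertex : Γ.Vertex → Γ.TorusVertex
  | .source i => .marked i
  | .white w => .white w
  | .black b => .black b
  | .sink j => .marked j

instance : Quiver Γ.TorusVertex :=
  ⟨fun u v => {e : Γ.Edge // Γ.glueVertex (Γ.src e) = u ∧ Γ.glueVertex (Γ.tgt e) = v}⟩

/-- The gluing map from the cylinder network to the torus network. -/
def glue : Γ.Vertex ⥤q Γ.TorusVertex where
  obj := Γ.glueVertex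
  map e := ⟨e.1, congrArg _ e.2.1, congrArg _ e.2.2⟩

open Classical in
/-- The coefficient at a white vertex: `1/2` if `e`, `f` are its first and second outgoing edges,
`-1/2` if they are the second and the first, and `0` otherwise. -/
def whiteCoeff (K : Type*) [Field K] (e f : Γ.Edge) : K :=
  match Γ.start e, Γ.start f with
  | .inr (.inl (w, false)), .inr (.inl (w', true)) => if w = w' then 1 / 2 else 0
  | .inr (.inl (w, true)), .inr (.inl (w', false)) => if w = w' then -(1 / 2) else 0
  | _, _ => 0

open Classical in
/-- The coefficient at a black vertex: `-1/2` if `e`, `f` are its first and second incoming edges,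
`1/2` if they are the second and the first, and `0` otherwise. -/
def blackCoeff (K : Type*) [Field K] (e f : Γ.Edge) : K :=
  match Γ.finish e, Γ.finish f with
  | .inr (.inr (b, false)), .inr (.inr (b', true)) => if b = b' then -(1 / 2) else 0
  | .inr (.inr (b, true)), .inr (.inr (b', false)) => if b = b' then 1 / 2 else 0
  | _, _ => 0

open Classical in
/-- The double brackets of edges, summed over the internal vertices:
`{{x₁, x₂}} = 1/2 x₁ ⊗ x₂` for the first and second outgoing edges of a white vertex,
`{{y₁, y₂}} = -1/2 y₂ ⊗ y₁` for the first and second incoming edges of a black vertex,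
the brackets with the opposite order of arguments by skew-symmetry, and no other contributions. -/
def edgeBracket (K : Type*) [Field K] : ArrowBracket K Γ.TorusVertex := fun a b c d e f =>
  (if h : a = c then
    Γ.whiteCoeff K e.1 f.1 •
      (ofPath K (Quiver.Hom.toPath (⟨e.1, e.2.1.trans h, e.2.2⟩ : c ⟶ b)) ⊗ₜ[K]
        ofPath K (Quiver.Hom.toPath (⟨f.1, f.2.1.trans h.symm, f.2.2⟩ : a ⟶ d)))
  else 0) +
  (if h : b = d then
    Γ.blackCoeff K e.1 f.1 •
      (ofPath K (Quiver.Hom.toPath (⟨f.1, f.2.1, f.2.2.trans h.symm⟩ : c ⟶ b)) ⊗ₜ[K]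
        ofPath K (Quiver.Hom.toPath (⟨e.1, e.2.1, e.2.2.trans h⟩ : a ⟶ d)))
  else 0)

/-! ### Boundary measurements -/

/-- The oriented intersection number of a path with the cut. -/
def crossing {u v : Γ.Vertex} (p : Quiver.Path u v) : ℤ :=
  Quiver.Path.addWeight
    (fun {u v : Γ.Vertex} (e : u ⟶ v) => Γ.cross (show {e // Γ.src e = u ∧ Γ.tgt e = v} from e).1) p

/-- Objects of the category `C` of paths of the torus network between the marked points. -/
abbrev marked : Fin N → Γ.TorusVertex := .marked

/-- There are finitely many paths between two vertices of an acyclic network. -/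
instance finite_path (u v : Γ.Vertex) : Finite (Quiver.Path u v) := by
  have hfin : Finite Γ.Vertex := by
    refine Finite.of_surjective
      (fun x : Fin N ⊕ Γ.White ⊕ Γ.Black ⊕ Fin N => (match x with
        | .inl i => .source i
        | .inr (.inl w) => .white w
        | .inr (.inr (.inl b)) => .black b
        | .inr (.inr (.inr j)) => .sink j : Γ.Vertex)) ?_
    rintro (i | w | b | j)
    exacts [⟨.inl i, rfl⟩, ⟨.inr (.inl w), rfl⟩, ⟨.inr (.inr (.inl b)), rfl⟩,
      ⟨.inr (.inr (.inr j)), rfl⟩]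
  let r : Γ.Vertex → Γ.Vertex → Prop := fun a b => ∃ p : Quiver.Path a b, p.length ≠ 0
  have htr : IsTrans Γ.Vertex r := ⟨fun a b c ⟨p, hp⟩ ⟨q, hq⟩ =>
    ⟨p.comp q, by rw [Quiver.Path.length_comp]; omega⟩⟩
  have hirr : Std.Irrefl r := ⟨fun a ⟨p, hp⟩ => hp (Γ.acyclic a p)⟩
  have hwf : WellFounded r := Finite.wellFounded_of_trans_of_irrefl r
  induction v using hwf.induction with
  | _ v ih =>
  have hsub : ∀ x : {e : Γ.Edge // Γ.tgt e = v}, Finite (Quiver.Path u (Γ.src x.1)) := fun x =>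
    ih _ ⟨(Quiver.Hom.toPath (⟨x.1, rfl, x.2⟩ : Γ.src x.1 ⟶ v)), by simp⟩
  refine Finite.of_surjective
    (fun x : PLift (u = v) ⊕ (Σ e : {e : Γ.Edge // Γ.tgt e = v}, Quiver.Path u (Γ.src e.1)) =>
      (match x with
        | .inl h => h.down ▸ .nil
        | .inr ⟨e, p⟩ => p.cons (⟨e.1, rfl, e.2⟩ : Γ.src e.1 ⟶ v) : Quiver.Path u v)) ?_
  intro p
  cases p with
  | nil => exact ⟨.inl ⟨rfl⟩, rfl⟩
  | cons p e =>
    obtain ⟨e, rfl, he⟩ := e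
    exact ⟨.inr ⟨⟨e, he⟩, p⟩, rfl⟩

/-- The boundary measurement matrix `B(z)`: its `(i,j)` entry is the sum, over the paths `p` from
the `i`-th source to the `j`-th sink, of `z ^ d` times the weight of `p`, where `d` is the oriented
intersection number of `p` with the cut. -/
def boundaryMeasurement {K : Type*} [Field K] (z : K) : PathMatrix K Γ.marked := fun i j =>
  ∑ᶠ p : Quiver.Path (PerfectNetwork.Vertex.source i : Γ.Vertex) (.sink j),
    z ^ Γ.crossing p • ofPath K (Γ.glue.mapPath p)

/-- The shifted matrix `X(z) = B(z) - 1`. -/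
def shiftedMeasurement {K : Type*} [Field K] (z : K) : PathMatrix K Γ.marked := fun i j =>
  Γ.boundaryMeasurement z i j - identityMatrix Γ.marked K i j

end CylindricalNetwork

/-! ## The trigonometric r-matrix and the ground field -/

/-- The coefficients `ρ_{ij}(λ, μ)` of the trigonometric r-matrix
`r(λ, μ) = ∑ ρ_{ij}(λ, μ) E_{ij} ⊠ E_{ji}`. -/
def rhoCoeff {K : Type*} [Field K] {N : ℕ} (lam mu : K) (i j : Fin N) : K :=
  if i < j then lam / (mu - lam)
  else if i = j then 1 / 2 * ((mu + lam) / (mu - lam))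
  else mu / (mu - lam)

/-- The field `ℂ(λ, μ)` of rational functions in two variables. -/
abbrev SpectralField : Type := FractionRing (MvPolynomial (Fin 2) ℂ)

/-- The spectral parameter `λ`. -/
def spectralLam : SpectralField := algebraMap (MvPolynomial (Fin 2) ℂ) SpectralField (.X 0)

/-- The spectral parameter `μ`. -/
def spectralMu : SpectralField := algebraMap (MvPolynomial (Fin 2) ℂ) SpectralField (.X 1)

/-! ## The Hamiltonian and the Lax matrix -/

namespace CylindricalNetwork

variable {N : ℕ} (Γ : CylindricalNetwork N N) {K : Type*} [Field K] (J : PathIdeal K Γ.marked)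

/-- The boundary measurement matrix regarded as a matrix over `Ĉ`. -/
def hatMeasurement (z : K) : J.HatMatrix := fun i j =>
  J.toCompletion i j (Γ.boundaryMeasurement z i j)

variable {lam : K} (hJ : ∀ i j : Fin N, Γ.shiftedMeasurement lam i j ∈ J.carrier i j)

/-- The matrix `log B(λ)` over `Ĉ`. -/
def logMeasurement : J.HatMatrix := J.logOneAdd (Γ.shiftedMeasurement lam) hJ

/-- The Hamiltonian `H(λ)`: the class of `1/2 tr ((log B(λ))²)` in the completed cyclic space. -/
def hamiltonian : J.cyclicCompletion :=
  (1 / 2 : K) • J.hatTrace (J.hatMul (Γ.logMeasurement J hJ) (Γ.logMeasurement J hJ))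

/-- The matrix with entries `ρ_{ji}(λ, μ) (log B(λ))_{ij}`. -/
def laxMatrix (mu : K) : J.HatMatrix := fun i j =>
  rhoCoeff lam mu j i • Γ.logMeasurement J hJ i j

end CylindricalNetwork

end

/-!
The generating functions of the paths through an edge, weighted by `μ` before the edge and by `λ`
after it, are `1`-cycles, relative to the boundary, with coefficients in the local system of
monodromy `λ / μ` around the cylinder. Since `λ ≠ μ`, the first homology of the cylinder with these
coefficients vanishes, so every such cycle is the jump across the edges of a section over the faces
of the network. Pairing this section with a second cycle turns the sum of the local contributions to
the double bracket into a discrete divergence, of which only boundary averages survive; these are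
the coefficients `ρ`, and the result is an r-matrix formula for the double bracket of `B(λ)` and
`B(μ)`.

The bracket of the trace of `q(X)` with an element depends on `q` only through `q'(X)`. For
`q = 1/2 log² (1 + X)` one has `(1 + X) q' = log (1 + X)`, which turns the r-matrix formula into the
Lax equation.
-/

noncomputable section

/-! ## Potentials on the orbits of a bijection -/

section Potential

variable {D A : Type*} [AddCommGroup A] {σ : D → D}

theorem exists_iterate_eq_of_mk_eq [Finite D] (hσ : Function.Injective σ) {a b : D}
    (h : Quot.mk (fun d d' : D => σ d = d') a = Quot.mk _ b) : ∃ k : ℕ, σ^[k] a = b := by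
  have hgen := Quot.eqvGen_exact h
  clear h
  induction hgen with
  | rel a b h => exact ⟨1, h⟩
  | refl a => exact ⟨0, rfl⟩
  | symm a b _ ih =>
    obtain ⟨k, rfl⟩ := ih
    obtain ⟨p, hp, hpa⟩ := Function.mem_periodicPts.1 (hσ.mem_periodicPts a)
    refine ⟨p * k - k, ?_⟩
    rw [← Function.iterate_add_apply, Nat.sub_add_cancel (Nat.le_mul_of_pos_left k hp)]
    exact hpa.mul_const k
  | trans a b c _ _ ihab ihbc =>
    obtain ⟨k, rfl⟩ := ihab
    obtain ⟨l, rfl⟩ := ihbc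
    exact ⟨l + k, Function.iterate_add_apply σ l k a⟩

theorem mk_iterate (a : D) (k : ℕ) :
    Quot.mk (fun d d' : D => σ d = d') (σ^[k] a) = Quot.mk _ a := by
  induction k with
  | zero => rfl
  | succ k ih =>
    rw [Function.iterate_succ_apply', ← ih]
    exact (Quot.sound (r := fun d d' : D => σ d = d') rfl).symm

open Classical in
theorem birkhoffSum_minimalPeriod [Fintype D] (hσ : Function.Injective σ) (s : D → A) (a : D) :
    birkhoffSum σ s (Function.minimalPeriod σ a) a =
      ∑ d : D with Quot.mk (fun d d' : D => σ d = d') d = Quot.mk _ a, s d := by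
  refine Finset.sum_bij (fun j _ => σ^[j] a) ?_ ?_ ?_ (fun _ _ => rfl)
  · intro j _
    simpa using mk_iterate a j
  · intro j hj k hk h
    exact (Function.iterate_eq_iterate_iff_of_lt_minimalPeriod (Finset.mem_range.1 hj)
      (Finset.mem_range.1 hk)).1 h
  · intro b hb
    obtain ⟨k, rfl⟩ := exists_iterate_eq_of_mk_eq hσ (Finset.mem_filter.1 hb).2.symm
    refine ⟨k % Function.minimalPeriod σ a, ?_, Function.iterate_mod_minimalPeriod_eq⟩
    exact Finset.mem_range.2 (Nat.mod_lt _
      (Function.minimalPeriod_pos_of_mem_periodicPts (hσ.mem_periodicPts a)))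

theorem birkhoffSum_mul_eq_zero {s : D → A} {a : D} {p : ℕ} (hp : Function.IsPeriodicPt σ p a)
    (h : birkhoffSum σ s p a = 0) (q : ℕ) : birkhoffSum σ s (p * q) a = 0 := by
  induction q with
  | zero => simp
  | succ q ih => rw [Nat.mul_succ, birkhoffSum_add, ih, (hp.mul_const q).eq, h, add_zero]

theorem birkhoffSum_eq_of_iterate_eq {s : D → A}
    (hs : ∀ a, birkhoffSum σ s (Function.minimalPeriod σ a) a = 0) {a : D} {m n : ℕ}
    (h : σ^[m] a = σ^[n] a) : birkhoffSum σ s m a = birkhoffSum σ s n a := by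
  wlog hmn : m ≤ n generalizing m n
  · exact (this h.symm (Nat.le_of_not_le hmn)).symm
  obtain ⟨j, rfl⟩ := Nat.exists_eq_add_of_le hmn
  have hj : Function.IsPeriodicPt σ j (σ^[m] a) := by
    rw [Function.IsPeriodicPt, Function.IsFixedPt, ← Function.iterate_add_apply, add_comm, h]
  obtain ⟨q, rfl⟩ := hj.minimalPeriod_dvd
  rw [birkhoffSum_add, birkhoffSum_mul_eq_zero (Function.isPeriodicPt_minimalPeriod σ _) (hs _),
    add_zero]

open Classical in
theorem exists_potential [Fintype D] (hσ : Function.Injective σ) (s : D → A)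
    (hs : ∀ F : Quot (fun d d' : D => σ d = d'), ∑ d : D with Quot.mk _ d = F, s d = 0) :
    ∃ h : D → A, ∀ d, h (σ d) = h d + s d := by
  have hrep (d : D) : ∃ k : ℕ, σ^[k] d = (Quot.mk (fun d d' : D => σ d = d') d).out :=
    exists_iterate_eq_of_mk_eq hσ (Quot.out_eq _).symm
  choose k hk using hrep
  have hmk (d : D) : Quot.mk (fun d d' : D => σ d = d') (σ d) = Quot.mk _ d :=
    (Quot.sound (r := fun d d' : D => σ d = d') rfl).symm
  refine ⟨fun d => -birkhoffSum σ s (k d) d, fun d => ?_⟩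
  have hend : σ^[k d] d = σ^[k (σ d) + 1] d := by
    rw [hk, Function.iterate_succ_apply, hk, hmk]
  beta_reduce
  rw [birkhoffSum_eq_of_iterate_eq (fun a => (birkhoffSum_minimalPeriod hσ s a).trans (hs _)) hend,
    birkhoffSum_succ']
  abel

end Potential

/-! ## Combinatorics of perfect networks -/

namespace PerfectNetwork

variable {m n : ℕ} (Γ : PerfectNetwork m n)

/-- The edge at the `i`-th source. -/
abbrev sourceEdge (i : Fin m) : Γ.Edge := Γ.start.symm (.inl i)

/-- The edge at the `j`-th sink. -/
abbrev sinkEdge (j : Fin n) : Γ.Edge := Γ.finish.symm (.inl j)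

/-- The first (`c = false`) or second (`c = true`) outgoing edge of a white vertex. -/
abbrev whiteOut (w : Γ.White) (c : Bool) : Γ.Edge := Γ.start.symm (.inr (.inl (w, c)))

/-- The incoming edge of a white vertex. -/
abbrev whiteIn (w : Γ.White) : Γ.Edge := Γ.finish.symm (.inr (.inl w))

/-- The outgoing edge of a black vertex. -/
abbrev blackOut (b : Γ.Black) : Γ.Edge := Γ.start.symm (.inr (.inr b))

/-- The first (`c = false`) or second (`c = true`) incoming edge of a black vertex. -/
abbrev blackIn (b : Γ.Black) (c : Bool) : Γ.Edge := Γ.finish.symm (.inr (.inr (b, c)))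

instance : Finite Γ.Vertex := by
  refine Finite.of_surjective
    (fun x : Fin m ⊕ Γ.White ⊕ Γ.Black ⊕ Fin n => (match x with
      | .inl i => .source i
      | .inr (.inl w) => .white w
      | .inr (.inr (.inl b)) => .black b
      | .inr (.inr (.inr j)) => .sink j : Γ.Vertex)) ?_
  rintro (i | w | b | j)
  exacts [⟨.inl i, rfl⟩, ⟨.inr (.inl w), rfl⟩, ⟨.inr (.inr (.inl b)), rfl⟩,
    ⟨.inr (.inr (.inr j)), rfl⟩]

instance : Fintype Γ.Vertex := .ofFinite _

instance : DecidableEq Γ.Vertex := Classical.decEq _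

@[simp] theorem src_sourceEdge (i : Fin m) : Γ.src (Γ.sourceEdge i) = .source i := by
  simp [src]

@[simp] theorem src_whiteOut (w : Γ.White) (c : Bool) : Γ.src (Γ.whiteOut w c) = .white w := by
  simp [src]

@[simp] theorem src_blackOut (b : Γ.Black) : Γ.src (Γ.blackOut b) = .black b := by
  simp [src]

@[simp] theorem tgt_sinkEdge (j : Fin n) : Γ.tgt (Γ.sinkEdge j) = .sink j := by
  simp [tgt]

@[simp] theorem tgt_whiteIn (w : Γ.White) : Γ.tgt (Γ.whiteIn w) = .white w := by
  simp [tgt]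

@[simp] theorem tgt_blackIn (b : Γ.Black) (c : Bool) : Γ.tgt (Γ.blackIn b c) = .black b := by
  simp [tgt]

theorem edge_start_cases (e : Γ.Edge) : (∃ i, e = Γ.sourceEdge i) ∨
    (∃ w c, e = Γ.whiteOut w c) ∨ ∃ b, e = Γ.blackOut b := by
  obtain ⟨x, rfl⟩ := Γ.start.symm.surjective e
  rcases x with i | ⟨w, c⟩ | b
  exacts [.inl ⟨i, rfl⟩, .inr (.inl ⟨w, c, rfl⟩), .inr (.inr ⟨b, rfl⟩)]

section Sums

variable {M : Type*} [AddCommMonoid M] (F : Γ.Edge → M)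

theorem sum_edge_start :
    ∑ e, F e = ∑ i, F (Γ.sourceEdge i) +
      (∑ w, (F (Γ.whiteOut w false) + F (Γ.whiteOut w true)) + ∑ b, F (Γ.blackOut b)) := by
  rw [← Equiv.sum_comp Γ.start.symm F, Fintype.sum_sum_type, Fintype.sum_sum_type,
    Fintype.sum_prod_type]
  simp only [Fintype.sum_bool, add_comm (F (Γ.start.symm (.inr (.inl (_, true)))))]

theorem sum_edge_finish :
    ∑ e, F e = ∑ j, F (Γ.sinkEdge j) +
      (∑ w, F (Γ.whiteIn w) + ∑ b, (F (Γ.blackIn b false) + F (Γ.blackIn b true))) := by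
  rw [← Equiv.sum_comp Γ.finish.symm F, Fintype.sum_sum_type, Fintype.sum_sum_type,
    Fintype.sum_prod_type]
  simp only [Fintype.sum_bool, add_comm (F (Γ.finish.symm (.inr (.inr (_, true)))))]

theorem sum_src_eq_source (i : Fin m) :
    ∑ e with Γ.src e = .source i, F e = F (Γ.sourceEdge i) := by
  classical
  simp [Finset.sum_filter, sum_edge_start]

theorem sum_src_eq_white (w : Γ.White) :
    ∑ e with Γ.src e = .white w, F e = F (Γ.whiteOut w false) + F (Γ.whiteOut w true) := by
  classical
  simp [Finset.sum_filter, sum_edge_start, Finset.sum_add_distrib]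

theorem sum_src_eq_black (b : Γ.Black) :
    ∑ e with Γ.src e = .black b, F e = F (Γ.blackOut b) := by
  classical
  simp [Finset.sum_filter, sum_edge_start]

theorem sum_tgt_eq_sink (j : Fin n) : ∑ e with Γ.tgt e = .sink j, F e = F (Γ.sinkEdge j) := by
  classical
  simp [Finset.sum_filter, sum_edge_finish]

theorem sum_tgt_eq_white (w : Γ.White) :
    ∑ e with Γ.tgt e = .white w, F e = F (Γ.whiteIn w) := by
  classical
  simp [Finset.sum_filter, sum_edge_finish]

theorem sum_tgt_eq_black (b : Γ.Black) :
    ∑ e with Γ.tgt e = .black b, F e = F (Γ.blackIn b false) + F (Γ.blackIn b true) := by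
  classical
  simp [Finset.sum_filter, sum_edge_finish, Finset.sum_add_distrib]

end Sums

theorem rotate_surjective : Function.Surjective Γ.rotate := by
  rintro (e | e)
  · obtain ⟨i | ⟨w, _ | _⟩ | b, rfl⟩ := Γ.start.symm.surjective e
    · exact ⟨.inl (Γ.sourceEdge (finRotate m i)), by
        simp only [rotate, Equiv.apply_symm_apply, Equiv.symm_apply_apply]⟩
    · exact ⟨.inr (Γ.whiteIn w), by simp [rotate]⟩
    · exact ⟨.inl (Γ.whiteOut w false), by simp [rotate]⟩
    · exact ⟨.inr (Γ.blackIn b true), by simp [rotate]⟩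
  · obtain ⟨j | w | ⟨b, _ | _⟩, rfl⟩ := Γ.finish.symm.surjective e
    · exact ⟨.inr (Γ.sinkEdge ((finRotate n).symm j)), by
        simp only [rotate, Equiv.apply_symm_apply]⟩
    · exact ⟨.inl (Γ.whiteOut w true), by simp [rotate]⟩
    · exact ⟨.inl (Γ.blackOut b), by simp [rotate]⟩
    · exact ⟨.inr (Γ.blackIn b false), by simp [rotate]⟩

theorem faceStep_injective : Function.Injective Γ.faceStep :=
  (Finite.injective_iff_surjective.2 Γ.rotate_surjective).comp Sum.swap_leftInverse.injective

variable {Γ}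

theorem IsAcyclic.wellFounded (h : Γ.IsAcyclic) :
    WellFounded fun u v : Γ.Vertex => ∃ e, Γ.src e = u ∧ Γ.tgt e = v := by
  let reaches (u v : Γ.Vertex) : Prop := ∃ p : Quiver.Path u v, p.length ≠ 0
  have htrans : IsTrans Γ.Vertex reaches := ⟨fun _ _ _ ⟨p, _⟩ ⟨q, _⟩ =>
    ⟨p.comp q, by rw [Quiver.Path.length_comp]; omega⟩⟩
  have hirrefl : Std.Irrefl reaches := ⟨fun v ⟨p, hp⟩ => hp (h v p)⟩
  refine Subrelation.wf (fun {u v} ⟨e, he⟩ => ?_)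
    (Finite.wellFounded_of_trans_of_irrefl reaches)
  exact ⟨Quiver.Hom.toPath (⟨e, he⟩ : u ⟶ v), by simp⟩

theorem IsAcyclic.edge_induction (h : Γ.IsAcyclic) {P : Γ.Edge → Prop}
    (hsource : ∀ i, P (Γ.sourceEdge i))
    (hwhite : ∀ w c, P (Γ.whiteIn w) → P (Γ.whiteOut w c))
    (hblack : ∀ b, P (Γ.blackIn b false) → P (Γ.blackIn b true) → P (Γ.blackOut b))
    (e : Γ.Edge) : P e := by
  induction hv : Γ.src e using h.wellFounded.induction generalizing e with
  | _ v ih =>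
  have hprev (f : Γ.Edge) (hf : Γ.tgt f = Γ.src e) : P f := ih _ ⟨f, rfl, hf.trans hv⟩ f rfl
  rcases Γ.edge_start_cases e with ⟨i, rfl⟩ | ⟨w, c, rfl⟩ | ⟨b, rfl⟩
  · exact hsource i
  · exact hwhite w c (hprev _ (by simp))
  · exact hblack b (hprev _ (by simp)) (hprev _ (by simp))

end PerfectNetwork

/-! ## Twisted homology of the cylinder -/

section CircleSection

variable {N : ℕ} {K : Type*} [Field K] {t : K}

/-- A section, along a boundary circle with `N` marked points, of the local system with monodromy
`t`: `L k` and `R k` are its values just above and just below the `k`-th marked point, which are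
constant between marked points, except that a factor `t` appears between the last and the first
one, where the cut ends. -/
def IsCircleSection (t : K) (L R : Fin N → K) : Prop :=
  ∀ k, R k = (if (k : ℕ) + 1 = N then t else 1) * L (finRotate N k)

theorem coe_finRotate_eq_zero_iff (k : Fin N) : (finRotate N k : ℕ) = 0 ↔ (k : ℕ) + 1 = N := by
  obtain _ | N := N
  · exact k.elim0
  · cases k using Fin.lastCases with
    | last => simp
    | cast k => simp [k.isLt.ne]

theorem IsCircleSection.eq_zero (ht : t ≠ 1) {M : Fin N → K} (hM : IsCircleSection t M M) :
    M = 0 := by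
  obtain _ | N := N
  · exact Subsingleton.elim _ _
  have hconst (k : Fin (N + 1)) : M k = M 0 := by
    induction k using Fin.induction with
    | zero => rfl
    | succ k ih => rw [← ih, hM k.castSucc]; simp [k.isLt.ne]
  have hmonodromy : M 0 = t * M 0 := by
    conv_lhs => rw [← hconst (Fin.last N), hM (Fin.last N), finRotate_last]
    simp
  have hzero : M 0 = 0 := by
    have : (1 - t) * M 0 = 0 := by linear_combination hmonodromy
    exact (mul_eq_zero.1 this).resolve_left (sub_ne_zero.2 ht.symm)
  exact funext fun k => (hconst k).trans hzero

theorem IsCircleSection.one_sub_mul_eq (ht : t ≠ 1) {L R : Fin N → K}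
    (h : IsCircleSection t L R) {i : Fin N} {c : K}
    (hjump : ∀ k, L k - R k = if k = i then c else 0) (k : Fin N) :
    (1 - t) * L k = (if i < k then t else 1) * c := by
  suffices hM : IsCircleSection t (fun k => (1 - t) * L k - (if i < k then t else 1) * c)
      fun k => (1 - t) * L k - (if i < k then t else 1) * c from
    sub_eq_zero.1 (congrFun (hM.eq_zero ht) k)
  intro k
  beta_reduce
  rw [sub_eq_iff_eq_add.1 (hjump k), h k]
  obtain _ | N := N
  · exact k.elim0
  cases k using Fin.lastCases with
  | last =>
    rcases (Fin.le_last i).eq_or_lt with rfl | hi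
    · simp only [↓reduceIte, Fin.val_last, finRotate_apply, Fin.last_add_one,
        lt_self_iff_false, one_mul, not_lt_zero]
      ring
    · simp only [hi.ne', ↓reduceIte, Fin.val_last, finRotate_apply, Fin.last_add_one,
        zero_add, hi, not_lt_zero, one_mul]
      ring
  | cast k =>
    rcases lt_trichotomy i k.castSucc with hi | rfl | hi
    · have hsucc := hi.trans k.castSucc_lt_succ
      simp [k.isLt.ne, hi, hi.ne', hsucc]
    · simp only [↓reduceIte, Fin.val_castSucc, Nat.add_right_cancel_iff, k.isLt.ne,
        finRotate_apply, Fin.coeSucc_eq_succ, one_mul, lt_self_iff_false,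
        Fin.castSucc_lt_succ_iff, Std.le_refl]
      ring
    · have hsucc := Fin.castSucc_lt_iff_succ_le.1 hi
      simp [k.isLt.ne, hi.not_gt, hi.ne, hsucc.not_gt]

end CircleSection

namespace PerfectNetwork

section TwistedHomology

variable {m n : ℕ} {Γ : PerfectNetwork m n} {K : Type*} [Field K]

/-- The inclusion of the internal vertices, taken as a type, into the vertices. -/
abbrev internalVertex : Γ.White ⊕ Γ.Black → Γ.Vertex := Sum.elim .white .black

variable (cross : Γ.Edge → ℤ) (t : K)

/-- The boundary, at the internal vertices, of a chain with coefficients in the local system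
with monodromy `t` around the cylinder. The local system is trivialized away from the cut, and the
coefficient of an edge is its value at the foot of the edge. -/
def twistedBoundary : (Γ.Edge → K) →ₗ[K] (Γ.White ⊕ Γ.Black → K) where
  toFun U x := ∑ e with Γ.tgt e = internalVertex x, t ^ cross e * U e -
    ∑ e with Γ.src e = internalVertex x, U e
  map_add' U U' := by
    ext x
    simp only [Pi.add_apply, mul_add, Finset.sum_add_distrib]
    ring
  map_smul' r U := by
    ext x
    simp only [Pi.smul_apply, smul_eq_mul, mul_left_comm _ r, ← Finset.mul_sum, ← mul_sub,
      RingHom.id_apply]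

theorem twistedBoundary_apply (U : Γ.Edge → K) (x : Γ.White ⊕ Γ.Black) :
    twistedBoundary cross t U x = ∑ e with Γ.tgt e = internalVertex x, t ^ cross e * U e -
      ∑ e with Γ.src e = internalVertex x, U e := rfl

theorem twistedBoundary_white (U : Γ.Edge → K) (w : Γ.White) :
    twistedBoundary cross t U (.inl w) = t ^ cross (Γ.whiteIn w) * U (Γ.whiteIn w) -
      (U (Γ.whiteOut w false) + U (Γ.whiteOut w true)) :=
  congrArg₂ (· - ·) (Γ.sum_tgt_eq_white (fun e => t ^ cross e * U e) w)
    (Γ.sum_src_eq_white U w)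

theorem twistedBoundary_black (U : Γ.Edge → K) (b : Γ.Black) :
    twistedBoundary cross t U (.inr b) =
      t ^ cross (Γ.blackIn b false) * U (Γ.blackIn b false) +
      t ^ cross (Γ.blackIn b true) * U (Γ.blackIn b true) - U (Γ.blackOut b) :=
  congrArg₂ (· - ·) (Γ.sum_tgt_eq_black (fun e => t ^ cross e * U e) b)
    (Γ.sum_src_eq_black U b)

/-- The class of a vertex in the `0`-chains relative to the boundary circles. -/
def vertexClass (K : Type*) [Field K] (v : Γ.Vertex) : Γ.White ⊕ Γ.Black → K :=
  fun x => if internalVertex x = v then 1 else 0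

open Classical in
theorem vertexClass_internalVertex (x : Γ.White ⊕ Γ.Black) :
    vertexClass K (internalVertex x) = Pi.single x 1 := by
  ext y
  rcases x with w | b <;> rcases y with w' | b' <;> simp [vertexClass, Pi.single_apply]

open Classical in
theorem twistedBoundary_single (e : Γ.Edge) :
    twistedBoundary cross t (Pi.single e 1) =
      t ^ cross e • vertexClass K (Γ.tgt e) - vertexClass K (Γ.src e) := by
  ext x
  simp [twistedBoundary_apply, vertexClass, Pi.single_apply, eq_comm]

variable {cross t}

theorem vertexClass_mem_range_twistedBoundary (hΓ : Γ.IsAcyclic) (ht : t ≠ 0) (v : Γ.Vertex) :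
    vertexClass K v ∈ LinearMap.range (twistedBoundary cross t) := by
  classical
  induction v using hΓ.wellFounded.induction with
  | _ v ih =>
  by_cases hv : ∃ e, Γ.tgt e = v
  · obtain ⟨e, rfl⟩ := hv
    have hsrc := ih _ ⟨e, rfl, rfl⟩
    have htgt :
        t ^ cross e • vertexClass K (Γ.tgt e) ∈ LinearMap.range (twistedBoundary cross t) :=
      (Submodule.sub_mem_iff_left _ hsrc).1 ⟨_, twistedBoundary_single cross t e⟩
    exact (Submodule.smul_mem_iff _ (zpow_ne_zero _ ht)).1 htgt
  · have hzero : vertexClass K v = 0 := by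
      ext (w | b)
      · exact if_neg fun h => hv ⟨Γ.whiteIn w, (Γ.tgt_whiteIn w).trans h⟩
      · exact if_neg fun h => hv ⟨Γ.blackIn b false, (Γ.tgt_blackIn b false).trans h⟩
    exact hzero ▸ zero_mem _

theorem twistedBoundary_surjective (hΓ : Γ.IsAcyclic) (ht : t ≠ 0) :
    Function.Surjective (twistedBoundary cross t) := by
  classical
  rw [← LinearMap.range_eq_top, eq_top_iff, ← (Pi.basisFun K (Γ.White ⊕ Γ.Black)).span_eq,
    Submodule.span_le]
  rintro _ ⟨x, rfl⟩
  rw [Pi.basisFun_apply, ← vertexClass_internalVertex]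
  exact vertexClass_mem_range_twistedBoundary hΓ ht _

variable (cross t)

/-- A section over the faces of the local system with monodromy `t`: its value at a dart is the
value on the face to the right of the dart, in the trivialization at the foot of the dart. -/
def IsFaceSection (φ : Γ.Dart → K) : Prop :=
  ∀ d, φ (Γ.faceStep d) = t ^ stepCrossing cross d * φ d

/-- The jump of a section over the faces across the edges, from left to right, in the
trivialization at the foot of the edge. -/
def jump : (Γ.Dart → K) →ₗ[K] (Γ.Edge → K) where
  toFun φ e := t ^ (-cross e) * φ (.inr e) - φ (.inl e)
  map_add' φ φ' := by ext e; simp only [Pi.add_apply]; ring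
  map_smul' r φ := by
    ext e; simp only [Pi.smul_apply, smul_eq_mul, RingHom.id_apply]; ring

theorem jump_apply (φ : Γ.Dart → K) (e : Γ.Edge) :
    jump cross t φ e = t ^ (-cross e) * φ (.inr e) - φ (.inl e) := rfl

variable {cross t}

namespace IsFaceSection

variable {φ : Γ.Dart → K} (h : IsFaceSection cross t φ)
include h

theorem whiteIn_right (w : Γ.White) :
    φ (.inl (Γ.whiteOut w false)) = t ^ cross (Γ.whiteIn w) * φ (.inl (Γ.whiteIn w)) := by
  simpa [faceStep, rotate, stepCrossing] using h (.inl (Γ.whiteIn w))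

theorem whiteOut_middle (w : Γ.White) :
    φ (.inl (Γ.whiteOut w true)) =
      t ^ (-cross (Γ.whiteOut w false)) * φ (.inr (Γ.whiteOut w false)) := by
  simpa [faceStep, rotate, stepCrossing] using h (.inr (Γ.whiteOut w false))

theorem whiteIn_left (w : Γ.White) :
    φ (.inr (Γ.whiteIn w)) =
      t ^ (-cross (Γ.whiteOut w true)) * φ (.inr (Γ.whiteOut w true)) := by
  simpa [faceStep, rotate, stepCrossing] using h (.inr (Γ.whiteOut w true))

theorem blackIn_middle (b : Γ.Black) :
    φ (.inr (Γ.blackIn b true)) =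
      t ^ cross (Γ.blackIn b false) * φ (.inl (Γ.blackIn b false)) := by
  simpa [faceStep, rotate, stepCrossing] using h (.inl (Γ.blackIn b false))

theorem blackOut_right (b : Γ.Black) :
    φ (.inl (Γ.blackOut b)) =
      t ^ cross (Γ.blackIn b true) * φ (.inl (Γ.blackIn b true)) := by
  simpa [faceStep, rotate, stepCrossing] using h (.inl (Γ.blackIn b true))

theorem blackOut_left (b : Γ.Black) :
    φ (.inr (Γ.blackIn b false)) = t ^ (-cross (Γ.blackOut b)) * φ (.inr (Γ.blackOut b)) := by
  simpa [faceStep, rotate, stepCrossing] using h (.inr (Γ.blackOut b))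

theorem isCircleSection_source (ht : t ≠ 0) :
    IsCircleSection t
      (fun i => t ^ (-cross (Γ.sourceEdge i)) * φ (.inr (Γ.sourceEdge i)))
      (fun i => φ (.inl (Γ.sourceEdge i))) := by
  intro k
  have hstep := h (.inr (Γ.sourceEdge (finRotate m k)))
  simp only [faceStep, rotate, stepCrossing, Sum.swap_inr, Equiv.apply_symm_apply,
    Equiv.symm_apply_apply, coe_finRotate_eq_zero_iff, zpow_add₀ ht] at hstep
  beta_reduce
  rw [hstep, ← mul_assoc, mul_comm (t ^ (-_ : ℤ))]
  split_ifs <;> simp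

theorem isCircleSection_sink (ht : t ≠ 0) :
    IsCircleSection t
      (fun j => φ (.inr (Γ.sinkEdge j)))
      (fun j => t ^ cross (Γ.sinkEdge j) * φ (.inl (Γ.sinkEdge j))) := by
  intro k
  have hstep := h (.inl (Γ.sinkEdge k))
  simp only [faceStep, rotate, stepCrossing, Sum.swap_inl, Equiv.apply_symm_apply,
    zpow_add₀ ht] at hstep
  beta_reduce
  rw [hstep]
  split_ifs
  · rw [zpow_neg_one]; field_simp
  · simp

theorem twistedBoundary_jump (ht : t ≠ 0) :
    twistedBoundary cross t (jump cross t φ) = 0 := by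
  have hcancel (k : ℤ) : t ^ k * t ^ (-k) = 1 := by
    rw [← zpow_add₀ ht, add_neg_cancel, zpow_zero]
  ext (w | b)
  · simp only [twistedBoundary_white, jump_apply, mul_sub, ← mul_assoc, hcancel, one_mul,
      ← h.whiteIn_right, h.whiteIn_left, ← h.whiteOut_middle]
    simp
  · simp only [twistedBoundary_black, jump_apply, mul_sub, ← mul_assoc, hcancel, one_mul,
      ← h.blackIn_middle, ← h.blackOut_right, h.blackOut_left]
    simp

theorem eq_zero_of_jump_eq_zero (hΓ : Γ.IsAcyclic) (ht : t ≠ 0) (ht1 : t ≠ 1)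
    (hjump : jump cross t φ = 0) : φ = 0 := by
  have hleft (e : Γ.Edge) : t ^ (-cross e) * φ (.inr e) = φ (.inl e) :=
    sub_eq_zero.1 (congrFun hjump e)
  have hright (e : Γ.Edge) : φ (.inl e) = 0 := by
    refine hΓ.edge_induction (P := fun e => φ (.inl e) = 0) (fun i => ?_) (fun w c hw => ?_)
      (fun b _ hb => ?_) e
    · have hsource := h.isCircleSection_source ht
      simp only [hleft] at hsource
      exact congrFun (hsource.eq_zero ht1) i
    · have hfirst : φ (.inl (Γ.whiteOut w false)) = 0 := by rw [h.whiteIn_right, hw, mul_zero]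
      cases c
      · exact hfirst
      · rw [h.whiteOut_middle, hleft, hfirst]
    · rw [h.blackOut_right, hb, mul_zero]
  ext (e | e)
  · exact hright e
  · simpa [hright e, zpow_ne_zero _ ht] using hleft e

end IsFaceSection

theorem finrank_ker_twistedBoundary (hΓ : Γ.IsAcyclic) (hcyl : Γ.IsCylindrical) (ht : t ≠ 0) :
    Module.finrank K (LinearMap.ker (twistedBoundary cross t)) = Nat.card Γ.Face := by
  have hrank := LinearMap.finrank_range_add_finrank_ker (twistedBoundary cross t)
  rw [LinearMap.range_eq_top.2 (twistedBoundary_surjective hΓ ht), finrank_top,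
    Module.finrank_fintype_fun_eq_card, Module.finrank_fintype_fun_eq_card,
    Fintype.card_sum] at hrank
  have heuler : _ + _ = _ := hcyl
  omega

/-- A function on the faces, transported along each face boundary by a potential of
`stepCrossing`. -/
def faceSectionOfPotential (t : K) (p : Γ.Dart → ℤ) : (Γ.Face → K) →ₗ[K] (Γ.Dart → K) where
  toFun ψ d := t ^ p d * ψ (Quot.mk _ d)
  map_add' ψ ψ' := by ext d; simp only [Pi.add_apply]; ring
  map_smul' r ψ := by
    ext d; simp only [Pi.smul_apply, smul_eq_mul, RingHom.id_apply]; ring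

theorem faceSectionOfPotential_apply (p : Γ.Dart → ℤ) (ψ : Γ.Face → K) (d : Γ.Dart) :
    faceSectionOfPotential t p ψ d = t ^ p d * ψ (Quot.mk _ d) := rfl

theorem isFaceSection_faceSectionOfPotential (ht : t ≠ 0) {p : Γ.Dart → ℤ}
    (hp : ∀ d, p (Γ.faceStep d) = p d + stepCrossing cross d) (ψ : Γ.Face → K) :
    IsFaceSection cross t (faceSectionOfPotential t p ψ) := by
  intro d
  rw [faceSectionOfPotential_apply, faceSectionOfPotential_apply, hp, zpow_add₀ ht,
    ← Quot.sound (r := fun d d' : Γ.Dart => Γ.faceStep d = d') (a := d) rfl]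
  ring

theorem faceSectionOfPotential_injective (ht : t ≠ 0) (p : Γ.Dart → ℤ) :
    Function.Injective (faceSectionOfPotential t p) := by
  intro ψ ψ' h
  ext F
  obtain ⟨d, rfl⟩ := Quot.exists_rep F
  exact mul_left_cancel₀ (zpow_ne_zero _ ht) (congrFun h d)

/-- This is the vanishing of the first twisted homology of the cylinder. Shrinking the boundary
circles to points gives a spherical graph, so face sections and cycles have the same dimension by
Euler's formula, and `jump` is injective because nontrivial monodromy kills invariant sections. -/
theorem exists_isFaceSection_jump_eq (hΓ : Γ.IsAcyclic) (hcyl : Γ.IsCylindrical)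
    (hcut : Γ.IsCut cross) (ht : t ≠ 0) (ht1 : t ≠ 1) {U : Γ.Edge → K}
    (hU : twistedBoundary cross t U = 0) :
    ∃ φ, IsFaceSection cross t φ ∧ jump cross t φ = U := by
  classical
  obtain ⟨p, hp⟩ := exists_potential Γ.faceStep_injective (stepCrossing cross) hcut
  have hsection := isFaceSection_faceSectionOfPotential ht hp
  set faceJump := jump cross t ∘ₗ faceSectionOfPotential t p
  have hinj : Function.Injective faceJump := by
    rw [← LinearMap.ker_eq_bot, LinearMap.ker_eq_bot']
    intro ψ hψ
    refine faceSectionOfPotential_injective ht p ?_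
    rw [map_zero]
    exact (hsection ψ).eq_zero_of_jump_eq_zero hΓ ht ht1 hψ
  have hle : LinearMap.range faceJump ≤ LinearMap.ker (twistedBoundary cross t) := by
    rintro _ ⟨ψ, rfl⟩
    exact (hsection ψ).twistedBoundary_jump ht
  have := Fintype.ofFinite Γ.Face
  have heq : LinearMap.range faceJump = LinearMap.ker (twistedBoundary cross t) :=
    Submodule.eq_of_le_of_finrank_eq hle <| by
      rw [LinearMap.finrank_range_of_inj hinj, finrank_ker_twistedBoundary hΓ hcyl ht,
        Module.finrank_fintype_fun_eq_card, Nat.card_eq_fintype_card]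
  obtain ⟨ψ, rfl⟩ : U ∈ LinearMap.range faceJump := heq ▸ hU
  exact ⟨_, hsection ψ, rfl⟩

end TwistedHomology

end PerfectNetwork

/-! ## The intersection form of two flows -/

section BoundaryAverage

variable {N : ℕ} {K : Type*} [Field K] [NeZero (2 : K)] {lam mu : K}

theorem IsCircleSection.average_eq (hmu : mu ≠ 0) (hne : lam ≠ mu) {L R : Fin N → K}
    (h : IsCircleSection (lam / mu) L R) {i : Fin N} {c : K}
    (hjump : ∀ k, L k - R k = if k = i then c else 0) (k : Fin N) :
    1 / 2 * (L k + R k) = rhoCoeff lam mu i k * c := by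
  have ht : lam / mu ≠ 1 := fun h => hne ((div_eq_one_iff_eq hmu).1 h)
  have hsub : mu - lam ≠ 0 := sub_ne_zero.2 hne.symm
  have h2 : (2 : K) ≠ 0 := NeZero.ne 2
  have hL : L k = (if i < k then lam else mu) / (mu - lam) * c := by
    refine mul_left_cancel₀ (sub_ne_zero.2 ht.symm) ((h.one_sub_mul_eq ht hjump k).trans ?_)
    split_ifs <;> field_simp
  have hR : R k = L k - if k = i then c else 0 := by rw [← hjump k, sub_sub_cancel]
  rw [hR, hL, rhoCoeff]
  rcases lt_trichotomy i k with h | rfl | h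
  · simp only [if_pos h, if_neg h.ne']
    field_simp
    ring
  · simp only [lt_irrefl, if_false, if_true]
    field_simp
    ring
  · simp only [if_neg h.not_gt, if_neg h.ne, if_neg h.ne']
    field_simp
    ring

end BoundaryAverage

namespace PerfectNetwork

section Average

variable {m n : ℕ} {Γ : PerfectNetwork m n} {K : Type*} [Field K]

/-- The average of a section over the faces on the two sides of an edge, in the trivialization at
the foot of the edge. -/
def average (cross : Γ.Edge → ℤ) (t : K) (φ : Γ.Dart → K) (e : Γ.Edge) : K :=
  1 / 2 * (t ^ (-cross e) * φ (.inr e) + φ (.inl e))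

variable {cross : Γ.Edge → ℤ} {t : K}

theorem zpow_mul_jump (ht : t ≠ 0) (φ : Γ.Dart → K) (e : Γ.Edge) :
    t ^ cross e * jump cross t φ e = φ (.inr e) - t ^ cross e * φ (.inl e) := by
  rw [jump_apply, mul_sub, ← mul_assoc, ← zpow_add₀ ht, add_neg_cancel, zpow_zero, one_mul]

theorem zpow_mul_average (ht : t ≠ 0) (φ : Γ.Dart → K) (e : Γ.Edge) :
    t ^ cross e * average cross t φ e = 1 / 2 * (φ (.inr e) + t ^ cross e * φ (.inl e)) := by
  rw [average, mul_left_comm, mul_add, ← mul_assoc, ← zpow_add₀ ht, add_neg_cancel, zpow_zero,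
    one_mul]

theorem mul_average_eq (ht : t ≠ 0) (φ : Γ.Dart → K) (W : Γ.Edge → K) (e : Γ.Edge) :
    W e * average cross t φ e =
      t⁻¹ ^ cross e * W e * (1 / 2 * (φ (.inr e) + t ^ cross e * φ (.inl e))) := by
  rw [← zpow_mul_average ht, inv_zpow]
  field_simp [zpow_ne_zero (cross e) ht]

namespace IsFaceSection

variable {φ : Γ.Dart → K} (h : IsFaceSection cross t φ) {W : Γ.Edge → K}
include h

theorem white_pairing (ht : t ≠ 0) {w : Γ.White} (hW : twistedBoundary cross t⁻¹ W (.inl w) = 0) :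
    1 / 2 * (W (Γ.whiteOut w false) * jump cross t φ (Γ.whiteOut w true)) -
      1 / 2 * (W (Γ.whiteOut w true) * jump cross t φ (Γ.whiteOut w false)) =
    W (Γ.whiteIn w) * average cross t φ (Γ.whiteIn w) -
      (W (Γ.whiteOut w false) * average cross t φ (Γ.whiteOut w false) +
        W (Γ.whiteOut w true) * average cross t φ (Γ.whiteOut w true)) := by
  rw [twistedBoundary_white] at hW
  rw [mul_average_eq ht]
  simp only [average, jump_apply, ← h.whiteOut_middle, ← h.whiteIn_left, ← h.whiteIn_right]
  linear_combination (-(1 / 2) * (φ (.inr (Γ.whiteIn w)) + φ (.inl (Γ.whiteOut w false)))) * hW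

theorem black_pairing (ht : t ≠ 0) {b : Γ.Black} (hW : twistedBoundary cross t⁻¹ W (.inr b) = 0) :
    1 / 2 * (t⁻¹ ^ cross (Γ.blackIn b false) * W (Γ.blackIn b false) *
        (t ^ cross (Γ.blackIn b true) * jump cross t φ (Γ.blackIn b true))) -
      1 / 2 * (t⁻¹ ^ cross (Γ.blackIn b true) * W (Γ.blackIn b true) *
        (t ^ cross (Γ.blackIn b false) * jump cross t φ (Γ.blackIn b false))) =
    W (Γ.blackIn b false) * average cross t φ (Γ.blackIn b false) +
      W (Γ.blackIn b true) * average cross t φ (Γ.blackIn b true) -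
      W (Γ.blackOut b) * average cross t φ (Γ.blackOut b) := by
  rw [twistedBoundary_black] at hW
  rw [mul_average_eq ht φ W (Γ.blackIn b false), mul_average_eq ht φ W (Γ.blackIn b true),
    zpow_mul_jump ht, zpow_mul_jump ht]
  simp only [average, ← h.blackIn_middle, ← h.blackOut_left, ← h.blackOut_right]
  linear_combination
    (-(1 / 2) * (φ (.inr (Γ.blackIn b false)) + φ (.inl (Γ.blackOut b)))) * hW

end IsFaceSection

end Average

end PerfectNetwork

namespace CylindricalNetwork

section IntersectionForm

variable {N : ℕ} {Γ : CylindricalNetwork N N} {K : Type*} [Field K]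

theorem sum_whiteCoeff_mul (F : Γ.Edge → Γ.Edge → K) :
    ∑ e, ∑ f, Γ.whiteCoeff K e f * F e f =
      ∑ w, (1 / 2 * F (Γ.whiteOut w false) (Γ.whiteOut w true) -
        1 / 2 * F (Γ.whiteOut w true) (Γ.whiteOut w false)) := by
  classical
  simp only [Γ.sum_edge_start, whiteCoeff, Equiv.apply_symm_apply, zero_mul,
    Finset.sum_const_zero, zero_add, add_zero, ite_mul, neg_mul, sub_eq_add_neg,
    Finset.sum_add_distrib, Finset.sum_ite_eq, Finset.mem_univ, if_true]

theorem sum_blackCoeff_mul (F : Γ.Edge → Γ.Edge → K) :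
    ∑ e, ∑ f, Γ.blackCoeff K e f * F e f =
      ∑ b, (1 / 2 * F (Γ.blackIn b true) (Γ.blackIn b false) -
        1 / 2 * F (Γ.blackIn b false) (Γ.blackIn b true)) := by
  classical
  simp only [Γ.sum_edge_finish, blackCoeff, Equiv.apply_symm_apply, zero_mul,
    Finset.sum_const_zero, zero_add, add_zero, ite_mul, neg_mul, sub_eq_add_neg,
    Finset.sum_add_distrib, Finset.sum_ite_eq, Finset.mem_univ, if_true]
  rw [add_comm]

/-- The local contributions add up to the divergence of `W e * average φ e`, so that by a discrete
Stokes formula only the boundary remains. -/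
theorem intersectionForm_jump {t : K} (ht : t ≠ 0) {φ : Γ.Dart → K}
    (hφ : PerfectNetwork.IsFaceSection Γ.cross t φ) {W : Γ.Edge → K}
    (hW : PerfectNetwork.twistedBoundary Γ.cross t⁻¹ W = 0) :
    ∑ e, ∑ f, Γ.whiteCoeff K e f * (W e * PerfectNetwork.jump Γ.cross t φ f) +
      ∑ e, ∑ f, Γ.blackCoeff K e f * (t⁻¹ ^ Γ.cross f * W f *
        (t ^ Γ.cross e * PerfectNetwork.jump Γ.cross t φ e)) =
    ∑ k, W (Γ.sourceEdge k) * PerfectNetwork.average Γ.cross t φ (Γ.sourceEdge k) -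
      ∑ k, W (Γ.sinkEdge k) * PerfectNetwork.average Γ.cross t φ (Γ.sinkEdge k) := by
  have hstokes := (Γ.sum_edge_start _).symm.trans
    (Γ.sum_edge_finish fun e => W e * PerfectNetwork.average Γ.cross t φ e)
  rw [sum_whiteCoeff_mul, sum_blackCoeff_mul fun e f => t⁻¹ ^ Γ.cross f * W f *
      (t ^ Γ.cross e * PerfectNetwork.jump Γ.cross t φ e),
    Finset.sum_congr rfl fun w _ => hφ.white_pairing ht (congrFun hW (.inl w)),
    Finset.sum_congr rfl fun b _ => hφ.black_pairing ht (congrFun hW (.inr b)),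
    Finset.sum_sub_distrib, Finset.sum_sub_distrib]
  linear_combination -hstokes

/-- A flow through the network with coefficients in the local system with monodromy `t`, which
enters with intensity `A` at the `i`-th source and leaves with intensity `C` at the `j`-th sink. As
in `PerfectNetwork.twistedBoundary`, the value at an edge is taken at its foot. -/
structure IsFlow (Γ : CylindricalNetwork N N) (t : K) (i j : Fin N) (A C : K) (U : Γ.Edge → K) :
    Prop where
  twistedBoundary_eq_zero : PerfectNetwork.twistedBoundary Γ.cross t U = 0
  source (k : Fin N) : U (Γ.sourceEdge k) = if k = i then A else 0
  sink (k : Fin N) : t ^ Γ.cross (Γ.sinkEdge k) * U (Γ.sinkEdge k) = if k = j then C else 0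

theorem IsFlow.intersectionForm_eq [NeZero (2 : K)] {lam mu : K} (hlam : lam ≠ 0) (hmu : mu ≠ 0)
    (hne : lam ≠ mu) {i j k l : Fin N} {A A' C C' : K} {W U : Γ.Edge → K}
    (hW : Γ.IsFlow (mu / lam) k j A A' W) (hU : Γ.IsFlow (lam / mu) i l C C' U) :
    ∑ e, ∑ f, Γ.whiteCoeff K e f * (W e * U f) +
      ∑ e, ∑ f, Γ.blackCoeff K e f *
        ((mu / lam) ^ Γ.cross f * W f * ((lam / mu) ^ Γ.cross e * U e)) =
      rhoCoeff lam mu i k * (A * C) - rhoCoeff lam mu l j * (A' * C') := by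
  have ht : lam / mu ≠ 0 := div_ne_zero hlam hmu
  obtain ⟨φ, hφ, rfl⟩ := PerfectNetwork.exists_isFaceSection_jump_eq Γ.acyclic Γ.cylindrical
    Γ.isCut ht (fun h => hne ((div_eq_one_iff_eq hmu).1 h)) hU.twistedBoundary_eq_zero
  have hsource (k' : Fin N) : PerfectNetwork.average Γ.cross (lam / mu) φ (Γ.sourceEdge k') =
      rhoCoeff lam mu i k' * C :=
    (hφ.isCircleSection_source ht).average_eq hmu hne hU.source k'
  have hsink (k' : Fin N) : (lam / mu) ^ Γ.cross (Γ.sinkEdge k') *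
      PerfectNetwork.average Γ.cross (lam / mu) φ (Γ.sinkEdge k') = rhoCoeff lam mu l k' * C' := by
    rw [PerfectNetwork.zpow_mul_average ht]
    refine (hφ.isCircleSection_sink ht).average_eq hmu hne (fun k' => ?_) k'
    rw [← PerfectNetwork.zpow_mul_jump ht, hU.sink]
  have hout (k' : Fin N) : W (Γ.sinkEdge k') *
      PerfectNetwork.average Γ.cross (lam / mu) φ (Γ.sinkEdge k') =
      (if k' = j then A' else 0) * (rhoCoeff lam mu l k' * C') := by
    rw [← hW.sink, ← hsink, ← inv_div lam mu, inv_zpow]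
    field_simp [zpow_ne_zero (Γ.cross (Γ.sinkEdge k')) ht]
  rw [← inv_div lam mu] at hW ⊢
  rw [intersectionForm_jump ht hφ hW.twistedBoundary_eq_zero]
  simp only [hW.source, hsource, hout, ite_mul, zero_mul, Finset.sum_ite_eq', Finset.mem_univ,
    if_true]
  ring

end IntersectionForm

end CylindricalNetwork

/-! ## Matrices of morphisms -/

section Multiplication

variable {K : Type*} [Field K] {V : Type*} [Quiver V]

theorem concat_ofPath_nil {a b : V} (f : PathHom K a b) :
    concat f (ofPath K (.nil : Quiver.Path b b)) = f := by
  induction f using pathHom_induction with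
  | h0 => simp only [map_zero, LinearMap.zero_apply]
  | hadd x y hx hy => simp only [map_add, LinearMap.add_apply, hx, hy]
  | hsmul r x hx => simp only [map_smul, LinearMap.smul_apply, hx]
  | hp p => simp

theorem concat_nil_ofPath {a b : V} (f : PathHom K a b) :
    concat (ofPath K (.nil : Quiver.Path a a)) f = f := by
  induction f using pathHom_induction with
  | h0 => simp only [map_zero]
  | hadd x y hx hy => simp only [map_add, hx, hy]
  | hsmul r x hx => simp only [map_smul, hx]
  | hp p => simp

theorem mulRL_add {a b c d e : V} (f g : PathHom K b c) (t : PathHom K a b ⊗[K] PathHom K d e) :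
    mulRL (f + g) t = mulRL f t + mulRL g t := by
  simp only [mulRL, map_add, LinearMap.rTensor_add, LinearMap.add_apply]

theorem mulRR_add {a b c d e : V} (f g : PathHom K d e) (t : PathHom K a b ⊗[K] PathHom K c d) :
    mulRR (f + g) t = mulRR f t + mulRR g t := by
  simp only [mulRR, map_add, LinearMap.lTensor_add, LinearMap.add_apply]

theorem mulRL_sum {α : Type*} (s : Finset α) {a b c d e : V} (f : α → PathHom K b c)
    (t : PathHom K a b ⊗[K] PathHom K d e) :
    mulRL (∑ i ∈ s, f i) t = ∑ i ∈ s, mulRL (f i) t := by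
  simp only [mulRL, map_sum, ← LinearMap.coe_rTensorHom, LinearMap.sum_apply]

theorem mulRR_sum {α : Type*} (s : Finset α) {a b c d e : V} (f : α → PathHom K d e)
    (t : PathHom K a b ⊗[K] PathHom K c d) :
    mulRR (∑ i ∈ s, f i) t = ∑ i ∈ s, mulRR (f i) t := by
  simp only [mulRR, map_sum, ← LinearMap.coe_lTensorHom, LinearMap.sum_apply]

variable (β : ArrowBracket K V)

theorem doubleBracket_nil_left {a c d : V} (h : PathHom K c d) :
    doubleBracket β (ofPath K (.nil : Quiver.Path a a)) h = 0 := by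
  induction h using pathHom_induction with
  | h0 => simp only [map_zero]
  | hadd x y hx hy => simp only [map_add, hx, hy, add_zero]
  | hsmul r x hx => simp only [map_smul, hx, smul_zero]
  | hp p => simp [pathPathBracket]

theorem doubleBracket_nil_right {a b c : V} (f : PathHom K a b) :
    doubleBracket β f (ofPath K (.nil : Quiver.Path c c)) = 0 := by
  induction f using pathHom_induction with
  | h0 => simp only [map_zero, LinearMap.zero_apply]
  | hadd x y hx hy => simp only [map_add, LinearMap.add_apply, hx, hy, add_zero]
  | hsmul r x hx => simp only [map_smul, LinearMap.smul_apply, hx, smul_zero]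
  | hp p =>
    rw [doubleBracket_ofPath]
    induction p with
    | nil => rfl
    | cons p e ih => simp [pathPathBracket, arrowPathBracket, ih]

theorem doubleBracket_toPath {a b c d : V} (e : a ⟶ b) (f : c ⟶ d) :
    doubleBracket β (ofPath K e.toPath) (ofPath K f.toPath) = β e f := by
  rw [doubleBracket_ofPath]
  simp [Quiver.Hom.toPath, pathPathBracket, arrowPathBracket, mulLR_nil, mulLL_nil]

end Multiplication

section Matrix

variable {K : Type*} [Field K] {V : Type*} [Quiver V] {ι : Type*} {obj : ι → V}

section Identity

variable [DecidableEq ι]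

theorem identityMatrix_self (i : ι) : identityMatrix obj K i i = ofPath K .nil := by
  simp [identityMatrix]

theorem identityMatrix_of_ne {i j : ι} (h : i ≠ j) : identityMatrix obj K i j = 0 := by
  simp [identityMatrix, h]

theorem doubleBracket_identityMatrix_left (β : ArrowBracket K V) (i j : ι)
    {c d : V} (h : PathHom K c d) :
    doubleBracket β (identityMatrix obj K i j) h = 0 := by
  by_cases hij : i = j
  · subst hij
    rw [identityMatrix_self, doubleBracket_nil_left]
  · rw [identityMatrix_of_ne hij, map_zero, LinearMap.zero_apply]

theorem doubleBracket_identityMatrix_right (β : ArrowBracket K V) {a b : V}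
    (f : PathHom K a b) (i j : ι) :
    doubleBracket β f (identityMatrix obj K i j) = 0 := by
  by_cases hij : i = j
  · subst hij
    rw [identityMatrix_self, doubleBracket_nil_right]
  · rw [identityMatrix_of_ne hij, map_zero]

end Identity

variable [Fintype ι]

/-- The product of two matrices of morphisms. -/
def matrixMul : PathMatrix K obj →ₗ[K] PathMatrix K obj →ₗ[K] PathMatrix K obj :=
  LinearMap.mk₂ K (fun X Y i j => ∑ k, concat (X i k) (Y k j))
    (fun X X' Y => by
      ext1 i; ext1 j
      simp only [Pi.add_apply, map_add, LinearMap.add_apply, Finset.sum_add_distrib])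
    (fun r X Y => by
      ext1 i; ext1 j
      simp only [Pi.smul_apply, map_smul, LinearMap.smul_apply, Finset.smul_sum])
    (fun X Y Y' => by
      ext1 i; ext1 j
      simp only [Pi.add_apply, map_add, Finset.sum_add_distrib])
    (fun r X Y => by
      ext1 i; ext1 j
      simp only [Pi.smul_apply, map_smul, Finset.smul_sum])

theorem matrixMul_apply (X Y : PathMatrix K obj) (i j : ι) :
    matrixMul X Y i j = ∑ k, concat (X i k) (Y k j) := rfl

theorem matrixMul_assoc (X Y Z : PathMatrix K obj) :
    matrixMul (matrixMul X Y) Z = matrixMul X (matrixMul Y Z) := by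
  ext1 i; ext1 j
  simp only [matrixMul_apply, map_sum, LinearMap.sum_apply, concat_assoc]
  exact Finset.sum_comm

variable (β : ArrowBracket K V)

theorem doubleBracket_matrixMul_left (X Y : PathMatrix K obj) (i j : ι) {c d : V}
    (h : PathHom K c d) :
    doubleBracket β (matrixMul X Y i j) h =
      ∑ k, mulLR (X i k) (doubleBracket β (Y k j) h) +
        ∑ k, mulRL (Y k j) (doubleBracket β (X i k) h) := by
  simp only [matrixMul_apply, map_sum, LinearMap.sum_apply, doubleBracket_concat_left,
    Finset.sum_add_distrib]

theorem doubleBracket_matrixMul_right {a b : V} (f : PathHom K a b) (X Y : PathMatrix K obj)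
    (i j : ι) :
    doubleBracket β f (matrixMul X Y i j) =
      ∑ k, mulLL (X i k) (doubleBracket β f (Y k j)) +
        ∑ k, mulRR (Y k j) (doubleBracket β f (X i k)) := by
  simp only [matrixMul_apply, map_sum, doubleBracket_concat_right, Finset.sum_add_distrib]

variable [DecidableEq ι]

theorem identityMatrix_mul (X : PathMatrix K obj) : matrixMul (identityMatrix obj K) X = X := by
  ext1 i; ext1 j
  rw [matrixMul_apply, Finset.sum_eq_single i (fun k _ hk => by
    rw [identityMatrix_of_ne hk.symm, map_zero, LinearMap.zero_apply])
    (fun hi => absurd (Finset.mem_univ i) hi), identityMatrix_self, concat_nil_ofPath]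

theorem mul_identityMatrix (X : PathMatrix K obj) : matrixMul X (identityMatrix obj K) = X := by
  ext1 i; ext1 j
  rw [matrixMul_apply, Finset.sum_eq_single j (fun k _ hk => by
    rw [identityMatrix_of_ne hk, map_zero])
    (fun hj => absurd (Finset.mem_univ j) hj), identityMatrix_self, concat_ofPath_nil]

theorem sum_mulRL_identityMatrix {a c d : V} (j : ι)
    (t : ∀ k, PathHom K a (obj k) ⊗[K] PathHom K c d) :
    ∑ k, mulRL (identityMatrix obj K k j) (t k) = t j := by
  rw [Finset.sum_eq_single j (fun k _ hk => by simp [identityMatrix_of_ne hk, mulRL])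
    (fun hj => absurd (Finset.mem_univ j) hj), identityMatrix_self, mulRL_nil]

theorem sum_mulRR_identityMatrix {a b c : V} (j : ι)
    (t : ∀ k, PathHom K a b ⊗[K] PathHom K c (obj k)) :
    ∑ k, mulRR (identityMatrix obj K k j) (t k) = t j := by
  rw [Finset.sum_eq_single j (fun k _ hk => by simp [identityMatrix_of_ne hk, mulRR])
    (fun hj => absurd (Finset.mem_univ j) hj), identityMatrix_self, mulRR_nil]

section Resolvent

variable {β} {P E : PathMatrix K obj}

/-- The derivative of `P = (1 - E)⁻¹` is `P E' P`. -/
theorem doubleBracket_resolvent_left (hPE : P = identityMatrix obj K + matrixMul P E)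
    (hEP : P = identityMatrix obj K + matrixMul E P) (i j : ι) {c d : V} (h : PathHom K c d) :
    doubleBracket β (P i j) h =
      ∑ x, ∑ y, mulLR (P i x) (mulRL (P y j) (doubleBracket β (E x y) h)) := by
  have hD (y : ι) : doubleBracket β (P i y) h = ∑ x, mulLR (P i x) (doubleBracket β (E x y) h) +
      ∑ x, mulRL (E x y) (doubleBracket β (P i x) h) := by
    nth_rw 1 [hPE]
    rw [Pi.add_apply, Pi.add_apply, map_add, LinearMap.add_apply,
      doubleBracket_identityMatrix_left, zero_add, doubleBracket_matrixMul_left]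
  have hP (x : ι) : P x j = identityMatrix obj K x j + ∑ y, concat (E x y) (P y j) :=
    congrFun (congrFun hEP x) j
  have hexpand : ∑ x, mulRL (P x j) (doubleBracket β (P i x) h) = doubleBracket β (P i j) h +
      ∑ y, ∑ x, mulRL (concat (E x y) (P y j)) (doubleBracket β (P i x) h) := by
    simp only [fun x => congrArg (mulRL · (doubleBracket β (P i x) h)) (hP x), mulRL_add,
      mulRL_sum, Finset.sum_add_distrib, sum_mulRL_identityMatrix]
    rw [Finset.sum_comm]
  have hleibniz : ∑ y, mulRL (P y j) (doubleBracket β (P i y) h) =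
      ∑ x, ∑ y, mulLR (P i x) (mulRL (P y j) (doubleBracket β (E x y) h)) +
      ∑ y, ∑ x, mulRL (concat (E x y) (P y j)) (doubleBracket β (P i x) h) := by
    simp only [fun y => congrArg (mulRL (P y j)) (hD y), map_add, map_sum, mulRL_comp,
      Finset.sum_add_distrib, mulLR_mulRL]
    rw [Finset.sum_comm]
  let : AddCommGroup (PathHom K c (obj j) ⊗[K] PathHom K (obj i) d) :=
    Module.addCommMonoidToAddCommGroup K
  exact add_right_cancel (hexpand.symm.trans hleibniz)

theorem doubleBracket_resolvent_right (hPE : P = identityMatrix obj K + matrixMul P E)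
    (hEP : P = identityMatrix obj K + matrixMul E P) {a b : V} (f : PathHom K a b) (i j : ι) :
    doubleBracket β f (P i j) =
      ∑ x, ∑ y, mulLL (P i x) (mulRR (P y j) (doubleBracket β f (E x y))) := by
  have hD (y : ι) : doubleBracket β f (P i y) = ∑ x, mulLL (P i x) (doubleBracket β f (E x y)) +
      ∑ x, mulRR (E x y) (doubleBracket β f (P i x)) := by
    nth_rw 1 [hPE]
    rw [Pi.add_apply, Pi.add_apply, map_add, doubleBracket_identityMatrix_right, zero_add,
      doubleBracket_matrixMul_right]
  have hP (x : ι) : P x j = identityMatrix obj K x j + ∑ y, concat (E x y) (P y j) :=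
    congrFun (congrFun hEP x) j
  have hexpand : ∑ x, mulRR (P x j) (doubleBracket β f (P i x)) = doubleBracket β f (P i j) +
      ∑ y, ∑ x, mulRR (concat (E x y) (P y j)) (doubleBracket β f (P i x)) := by
    simp only [fun x => congrArg (mulRR · (doubleBracket β f (P i x))) (hP x), mulRR_add,
      mulRR_sum, Finset.sum_add_distrib, sum_mulRR_identityMatrix]
    rw [Finset.sum_comm]
  have hleibniz : ∑ y, mulRR (P y j) (doubleBracket β f (P i y)) =
      ∑ x, ∑ y, mulLL (P i x) (mulRR (P y j) (doubleBracket β f (E x y))) +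
      ∑ y, ∑ x, mulRR (concat (E x y) (P y j)) (doubleBracket β f (P i x)) := by
    simp only [fun y => congrArg (mulRR (P y j)) (hD y), map_add, map_sum, mulRR_comp,
      Finset.sum_add_distrib, mulLL_mulRR]
    rw [Finset.sum_comm]
  let : AddCommGroup (PathHom K (obj i) b ⊗[K] PathHom K a (obj j)) :=
    Module.addCommMonoidToAddCommGroup K
  exact add_right_cancel (hexpand.symm.trans hleibniz)

end Resolvent

end Matrix

/-! ## Generating functions of paths -/

/-- A path is either trivial or the extension of a path by a last arrow. -/
def lastArrowEquiv {V : Type*} [Quiver V] (u v : V) :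
    (PLift (u = v) ⊕ Σ x, Quiver.Path u x × (x ⟶ v)) ≃ Quiver.Path u v where
  toFun p := match p with
    | .inl h => h.down ▸ .nil
    | .inr ⟨_, p, e⟩ => p.cons e
  invFun p := match p with
    | .nil => .inl ⟨rfl⟩
    | .cons p e => .inr ⟨_, p, e⟩
  left_inv p := by
    rcases p with ⟨⟨rfl⟩⟩ | ⟨x, p, e⟩ <;> rfl
  right_inv p := by
    cases p <;> rfl

namespace CylindricalNetwork

variable {N : ℕ} (Γ : CylindricalNetwork N N)

instance (x y : Γ.Vertex) : Fintype (x ⟶ y) :=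
  inferInstanceAs (Fintype {e : Γ.Edge // Γ.src e = x ∧ Γ.tgt e = y})

section HomSums

variable {M : Type*} [AddCommMonoid M] (F : Γ.Edge → M)

theorem sum_hom (x y : Γ.Vertex) :
    ∑ e : x ⟶ y, F e.1 = ∑ e with Γ.src e = x ∧ Γ.tgt e = y, F e :=
  (Finset.sum_subtype _ (fun e => by simp) F).symm

theorem sum_sum_hom_left (x : Γ.Vertex) :
    ∑ y, ∑ e : x ⟶ y, F e.1 = ∑ e with Γ.src e = x, F e := by
  simp only [sum_hom, ← Finset.filter_filter]
  exact Finset.sum_fiberwise _ Γ.tgt F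

theorem sum_sum_hom_right (y : Γ.Vertex) :
    ∑ x, ∑ e : x ⟶ y, F e.1 = ∑ e with Γ.tgt e = y, F e := by
  simp only [sum_hom, and_comm (b := Γ.tgt _ = y), ← Finset.filter_filter]
  exact Finset.sum_fiberwise _ Γ.src F

theorem sum_sum_sum_hom : ∑ x : Γ.Vertex, ∑ y : Γ.Vertex, ∑ e : x ⟶ y, F e.1 = ∑ e, F e := by
  simp only [sum_sum_hom_left]
  exact Finset.sum_fiberwise _ Γ.src F

end HomSums

variable {K : Type*} [Field K]

section PathSum

/-- The arrow of the torus network given by an arrow of the cylindrical network. -/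
def glueHom {u v : Γ.Vertex} (e : u ⟶ v) : Γ.glueVertex u ⟶ Γ.glueVertex v :=
  Γ.glue.map e

/-- The image in the torus network of a path of the cylindrical network. -/
def gluePath {u v : Γ.Vertex} (p : Quiver.Path u v) :
    Quiver.Path (Γ.glueVertex u) (Γ.glueVertex v) :=
  Γ.glue.mapPath p

/-- The weighted morphism of the torus network given by an edge of the cylindrical network. -/
def arrowHom (z : K) {x y : Γ.Vertex} (e : x ⟶ y) :
    PathHom K (Γ.glueVertex x) (Γ.glueVertex y) :=
  z ^ Γ.cross e.1 • ofPath K (Γ.gluePath e.toPath)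

/-- The weighted adjacency matrix of the cylindrical network. -/
def edgeMatrix (z : K) : PathMatrix K Γ.glueVertex := fun x y => ∑ e : x ⟶ y, Γ.arrowHom z e

/-- The matrix of the weighted sums of the paths between two vertices. Its entries between sources
and sinks are the boundary measurements. -/
def pathSum (z : K) : PathMatrix K Γ.glueVertex := fun u v =>
  ∑ᶠ p : Quiver.Path u v, z ^ Γ.crossing p • ofPath K (Γ.gluePath p)

variable {Γ}

theorem crossing_cons {u v w : Γ.Vertex} (p : Quiver.Path u v) (e : v ⟶ w) :
    Γ.crossing (p.cons e) = Γ.crossing p + Γ.cross e.1 := by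
  simp [crossing, Quiver.Path.addWeight_cons]

theorem arrowHom_eq_smul {z z' : K} (hz' : z' ≠ 0) {x y : Γ.Vertex} (e : x ⟶ y) :
    Γ.arrowHom z e = (z / z') ^ Γ.cross e.1 • Γ.arrowHom z' e := by
  rw [arrowHom, arrowHom, smul_smul, div_zpow, div_mul_cancel₀ _ (zpow_ne_zero _ hz')]

theorem concat_arrowHom {z : K} (hz : z ≠ 0) {u x y : Γ.Vertex} (p : Quiver.Path u x)
    (e : x ⟶ y) :
    concat (z ^ Γ.crossing p • ofPath K (Γ.gluePath p)) (Γ.arrowHom z e) =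
      z ^ Γ.crossing (p.cons e) • ofPath K (Γ.gluePath (p.cons e)) := by
  rw [crossing_cons, zpow_add₀ hz, arrowHom, map_smul, map_smul, LinearMap.smul_apply,
    concat_ofPath, smul_smul, mul_comm]
  rfl

theorem pathSum_eq_mul_edgeMatrix {z : K} (hz : z ≠ 0) :
    Γ.pathSum z = identityMatrix Γ.glueVertex K + matrixMul (Γ.pathSum z) (Γ.edgeMatrix z) := by
  have hfin (u v : Γ.Vertex) : Fintype (Quiver.Path u v) := .ofFinite _
  ext1 u; ext1 v
  rw [Pi.add_apply, Pi.add_apply, matrixMul_apply]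
  simp only [pathSum, edgeMatrix, finsum_eq_sum_of_fintype]
  rw [← Equiv.sum_comp (lastArrowEquiv u v), Fintype.sum_sum_type, Fintype.sum_sigma]
  congr 1
  · by_cases h : u = v
    · subst h
      simp only [lastArrowEquiv, Equiv.coe_fn_mk, crossing, Quiver.Path.addWeight_nil,
        zpow_ofNat, pow_zero, one_smul, Finset.sum_const, Finset.card_univ,
        Fintype.card_unique, identityMatrix_self]
      rfl
    · have : IsEmpty (PLift (u = v)) := ⟨fun x => h x.down⟩
      rw [identityMatrix_of_ne h, Finset.univ_eq_empty, Finset.sum_empty]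
  · refine Finset.sum_congr rfl fun x _ => ?_
    simp only [map_sum, LinearMap.sum_apply, concat_arrowHom hz]
    rw [Fintype.sum_prod_type_right]
    rfl

theorem eq_zero_of_eq_mul_edgeMatrix {z : K} {R : PathMatrix K Γ.glueVertex}
    (hR : R = matrixMul R (Γ.edgeMatrix z)) : R = 0 := by
  ext1 u; ext1 v
  induction v using Γ.acyclic.wellFounded.induction with
  | _ v ih =>
  rw [hR, matrixMul_apply]
  refine Finset.sum_eq_zero fun x _ => ?_
  rw [edgeMatrix, map_sum]
  refine Finset.sum_eq_zero fun e _ => ?_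
  rw [ih x ⟨e.1, e.2⟩, Pi.zero_apply, Pi.zero_apply, map_zero, LinearMap.zero_apply]

theorem pathSum_eq_edgeMatrix_mul {z : K} (hz : z ≠ 0) :
    Γ.pathSum z = identityMatrix Γ.glueVertex K + matrixMul (Γ.edgeMatrix z) (Γ.pathSum z) := by
  refine (sub_eq_zero.1 (eq_zero_of_eq_mul_edgeMatrix (z := z) ?_)).symm
  have hPE : matrixMul (Γ.pathSum z) (Γ.edgeMatrix z) =
      Γ.pathSum z - identityMatrix Γ.glueVertex K :=
    eq_sub_of_add_eq' (pathSum_eq_mul_edgeMatrix hz).symm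
  simp only [map_sub, map_add, LinearMap.sub_apply, LinearMap.add_apply, matrixMul_assoc, hPE,
    identityMatrix_mul, mul_identityMatrix]
  abel

theorem pathSum_source {z : K} (hz : z ≠ 0) (u : Γ.Vertex) (i : Fin N) :
    Γ.pathSum z u (.source i) = identityMatrix Γ.glueVertex K u (.source i) := by
  have hempty (x : Γ.Vertex) : IsEmpty (x ⟶ .source i) := by
    refine ⟨fun ⟨e, _, he⟩ => ?_⟩
    obtain ⟨j | w | b, rfl⟩ := Γ.finish.symm.surjective e <;> simp [PerfectNetwork.tgt] at he
  rw [pathSum_eq_mul_edgeMatrix hz, Pi.add_apply, Pi.add_apply, matrixMul_apply, add_eq_left]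
  exact Finset.sum_eq_zero fun x _ => by
    rw [edgeMatrix, Finset.univ_eq_empty, Finset.sum_empty, map_zero]

theorem pathSum_sink {z : K} (hz : z ≠ 0) (j : Fin N) (v : Γ.Vertex) :
    Γ.pathSum z (.sink j) v = identityMatrix Γ.glueVertex K (.sink j) v := by
  have hempty (x : Γ.Vertex) : IsEmpty (.sink j ⟶ x) := by
    refine ⟨fun ⟨e, he, _⟩ => ?_⟩
    obtain ⟨i | w | b, rfl⟩ := Γ.start.symm.surjective e <;> simp [PerfectNetwork.src] at he
  rw [pathSum_eq_edgeMatrix_mul hz, Pi.add_apply, Pi.add_apply, matrixMul_apply, add_eq_left]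
  exact Finset.sum_eq_zero fun x _ => by
    rw [edgeMatrix, Finset.univ_eq_empty, Finset.sum_empty, map_zero, LinearMap.zero_apply]

end PathSum

section PathFlow

/-- The weighted sum of the paths from `u` to `v` through the edge `e`, with weight `z` before
`e`, and `z'` from `e` on. -/
def pathFlow (z z' : K) (u v : Γ.Vertex) (e : Γ.Edge) :
    PathHom K (Γ.glueVertex u) (Γ.glueVertex v) :=
  concat (concat (Γ.pathSum z u (Γ.src e))
    (Γ.arrowHom z' (⟨e, rfl, rfl⟩ : Γ.src e ⟶ Γ.tgt e))) (Γ.pathSum z' (Γ.tgt e) v)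

variable {Γ}

theorem pathFlow_hom (z z' : K) (u v : Γ.Vertex) {x y : Γ.Vertex} (e : x ⟶ y) :
    Γ.pathFlow z z' u v e.1 =
      concat (concat (Γ.pathSum z u x) (Γ.arrowHom z' e)) (Γ.pathSum z' y v) := by
  obtain ⟨e, rfl, rfl⟩ := e
  rfl

theorem smul_pathFlow_hom {z z' : K} (hz' : z' ≠ 0) (u v : Γ.Vertex) {x y : Γ.Vertex}
    (e : x ⟶ y) :
    (z / z') ^ Γ.cross e.1 • Γ.pathFlow z z' u v e.1 =
      concat (concat (Γ.pathSum z u x) (Γ.arrowHom z e)) (Γ.pathSum z' y v) := by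
  rw [pathFlow_hom, arrowHom_eq_smul (z := z) hz', map_smul, map_smul, LinearMap.smul_apply]

theorem sum_pathFlow_out {z z' : K} (hz' : z' ≠ 0) (u v x : Γ.Vertex) :
    ∑ e with Γ.src e = x, Γ.pathFlow z z' u v e =
      concat (Γ.pathSum z u x) (Γ.pathSum z' x v - identityMatrix Γ.glueVertex K x v) := by
  have hP : Γ.pathSum z' x v - identityMatrix Γ.glueVertex K x v =
      ∑ y, concat (∑ e : x ⟶ y, Γ.arrowHom z' e) (Γ.pathSum z' y v) :=
    sub_eq_of_eq_add' (congrFun (congrFun (pathSum_eq_edgeMatrix_mul hz') x) v)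
  simp only [← sum_sum_hom_left, pathFlow_hom, hP, map_sum, LinearMap.sum_apply, concat_assoc]

theorem sum_pathFlow_in {z z' : K} (hz : z ≠ 0) (hz' : z' ≠ 0) (u v x : Γ.Vertex) :
    ∑ e with Γ.tgt e = x, (z / z') ^ Γ.cross e • Γ.pathFlow z z' u v e =
      concat (Γ.pathSum z u x - identityMatrix Γ.glueVertex K u x) (Γ.pathSum z' x v) := by
  have hP : Γ.pathSum z u x - identityMatrix Γ.glueVertex K u x =
      ∑ y, concat (Γ.pathSum z u y) (∑ e : y ⟶ x, Γ.arrowHom z e) :=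
    sub_eq_of_eq_add' (congrFun (congrFun (pathSum_eq_mul_edgeMatrix hz) u) x)
  simp only [← sum_sum_hom_right, smul_pathFlow_hom hz', hP, map_sum, LinearMap.sum_apply]

variable {z z' : K} (hz : z ≠ 0) (hz' : z' ≠ 0) (k j : Fin N)
include hz hz'

theorem pathFlow_sourceEdge (i : Fin N) :
    Γ.pathFlow z z' (.source k) (.sink j) (Γ.sourceEdge i) =
      if i = k then Γ.boundaryMeasurement z' k j else 0 := by
  have hout := sum_pathFlow_out (Γ := Γ) (z := z) hz' (.source k) (.sink j) (.source i)
  rw [Γ.sum_src_eq_source, identityMatrix_of_ne (by simp), sub_zero, pathSum_source hz] at hout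
  rw [hout]
  split_ifs with hik
  · subst hik
    rw [identityMatrix_self, concat_nil_ofPath]
    rfl
  · rw [identityMatrix_of_ne (by simpa using Ne.symm hik), map_zero, LinearMap.zero_apply]
    rfl

theorem pathFlow_sinkEdge (i : Fin N) :
    (z / z') ^ Γ.cross (Γ.sinkEdge i) •
      Γ.pathFlow z z' (.source k) (.sink j) (Γ.sinkEdge i) =
      if i = j then Γ.boundaryMeasurement z k j else 0 := by
  have hin := sum_pathFlow_in (Γ := Γ) hz hz' (.source k) (.sink j) (.sink i)
  rw [Γ.sum_tgt_eq_sink (fun e => (z / z') ^ Γ.cross e •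
      Γ.pathFlow z z' (.source k) (.sink j) e), identityMatrix_of_ne (by simp), sub_zero,
    pathSum_sink hz'] at hin
  rw [hin]
  split_ifs with hij
  · subst hij
    rw [identityMatrix_self, concat_ofPath_nil]
    rfl
  · rw [identityMatrix_of_ne (by simpa using hij), map_zero]
    rfl

theorem pathFlow_conservation {u v x : Γ.Vertex} (hu : u ≠ x) (hv : x ≠ v) :
    ∑ e with Γ.tgt e = x, (z / z') ^ Γ.cross e • Γ.pathFlow z z' u v e =
      ∑ e with Γ.src e = x, Γ.pathFlow z z' u v e := by
  rw [sum_pathFlow_in hz hz', sum_pathFlow_out hz', identityMatrix_of_ne hu,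
    identityMatrix_of_ne hv, sub_zero, sub_zero]

theorem isFlow_pathFlow (P : Quiver.Path (Γ.marked k) (Γ.marked j)) :
    Γ.IsFlow (z / z') k j (Γ.boundaryMeasurement z' k j P) (Γ.boundaryMeasurement z k j P)
      (fun e => (Γ.pathFlow z z' (.source k) (.sink j) e :
        PathHom K (Γ.marked k) (Γ.marked j)) P) where
  twistedBoundary_eq_zero := by
    ext x
    have hcons (P : Quiver.Path (Γ.glueVertex (.source k)) (Γ.glueVertex (.sink j))) :=
      DFunLike.congr_fun (pathFlow_conservation hz hz' (x := PerfectNetwork.internalVertex x)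
        (by cases x <;> simp) (by cases x <;> simp)) P
    simp only [Finsupp.coe_finsetSum, Finset.sum_apply, Finsupp.smul_apply, smul_eq_mul] at hcons
    rw [PerfectNetwork.twistedBoundary_apply, Pi.zero_apply, sub_eq_zero]
    exact hcons P
  source i := by
    rw [pathFlow_sourceEdge hz hz']
    split_ifs <;> rfl
  sink i := by
    refine (DFunLike.congr_fun (pathFlow_sinkEdge hz hz' k j i) P).trans ?_
    split_ifs <;> rfl

end PathFlow

end CylindricalNetwork

/-! ## The r-matrix bracket -/

theorem finsuppTensorFinsupp'_ext {R α β : Type*} [CommSemiring R] {s t : (α →₀ R) ⊗[R] (β →₀ R)}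
    (h : ∀ a b, finsuppTensorFinsupp' R α β s (a, b) = finsuppTensorFinsupp' R α β t (a, b)) :
    s = t :=
  (finsuppTensorFinsupp' R α β).injective (Finsupp.ext fun x => h x.1 x.2)

namespace CylindricalNetwork

variable {N : ℕ} {Γ : CylindricalNetwork N N} {K : Type*} [Field K]

theorem whiteCoeff_of_src_ne {e f : Γ.Edge} (h : Γ.src e ≠ Γ.src f) :
    Γ.whiteCoeff K e f = 0 := by
  obtain ⟨i | ⟨w, _ | _⟩ | b, rfl⟩ := Γ.start.symm.surjective e <;>
  obtain ⟨i' | ⟨w', _ | _⟩ | b', rfl⟩ := Γ.start.symm.surjective f <;>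
  simp_all [whiteCoeff, PerfectNetwork.src]

theorem blackCoeff_of_tgt_ne {e f : Γ.Edge} (h : Γ.tgt e ≠ Γ.tgt f) :
    Γ.blackCoeff K e f = 0 := by
  obtain ⟨i | w | ⟨b, _ | _⟩, rfl⟩ := Γ.finish.symm.surjective e <;>
  obtain ⟨i' | w' | ⟨b', _ | _⟩, rfl⟩ := Γ.finish.symm.surjective f <;>
  simp_all [blackCoeff, PerfectNetwork.tgt]

theorem mul_edgeBracket {p q r s : Γ.TorusVertex}
    (A : ∀ x, PathHom K p (Γ.glueVertex x)) (B : ∀ x, PathHom K (Γ.glueVertex x) q)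
    (C : ∀ x, PathHom K r (Γ.glueVertex x)) (D : ∀ x, PathHom K (Γ.glueVertex x) s)
    {u v u' v' : Γ.Vertex} (e : u ⟶ v) (f : u' ⟶ v') :
    mulLR (A u) (mulRL (B v) (mulLL (C u') (mulRR (D v')
      (Γ.edgeBracket K (Γ.glueHom e) (Γ.glueHom f))))) =
    Γ.whiteCoeff K e.1 f.1 •
      (concat (concat (C u) (ofPath K (Γ.gluePath e.toPath))) (B v) ⊗ₜ[K]
        concat (concat (A u') (ofPath K (Γ.gluePath f.toPath))) (D v')) +
    Γ.blackCoeff K e.1 f.1 •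
      (concat (concat (C u') (ofPath K (Γ.gluePath f.toPath))) (B v') ⊗ₜ[K]
        concat (concat (A u) (ofPath K (Γ.gluePath e.toPath))) (D v)) := by
  rw [edgeBracket, map_add, map_add, map_add, map_add]
  congr 1
  · by_cases huu' : u = u'
    · subst huu'
      rw [dif_pos rfl]
      simp only [map_smul, mulLR, mulRL, mulLL, mulRR, LinearMap.lTensor_tmul,
        LinearMap.rTensor_tmul, LinearMap.flip_apply, concat_assoc]
      rfl
    · have hzero : Γ.whiteCoeff K e.1 f.1 = 0 := whiteCoeff_of_src_ne (by rwa [e.2.1, f.2.1])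
      have hglue : Γ.whiteCoeff K (Γ.glueHom e).1 (Γ.glueHom f).1 = 0 := hzero
      rw [hglue, hzero]
      split_ifs <;> simp
  · by_cases hvv' : v = v'
    · subst hvv'
      rw [dif_pos rfl]
      simp only [map_smul, mulLR, mulRL, mulLL, mulRR, LinearMap.lTensor_tmul,
        LinearMap.rTensor_tmul, LinearMap.flip_apply, concat_assoc]
      rfl
    · have hzero : Γ.blackCoeff K e.1 f.1 = 0 := blackCoeff_of_tgt_ne (by rwa [e.2.2, f.2.2])
      have hglue : Γ.blackCoeff K (Γ.glueHom e).1 (Γ.glueHom f).1 = 0 := hzero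
      rw [hglue, hzero]
      split_ifs <;> simp

variable {lam mu : K} (hlam : lam ≠ 0) (hmu : mu ≠ 0)
include hlam hmu

theorem mul_doubleBracket_arrowHom (u v u' v' : Γ.Vertex) {x y x' y' : Γ.Vertex} (e : x ⟶ y)
    (f : x' ⟶ y') :
    mulLR (Γ.pathSum lam u x) (mulRL (Γ.pathSum lam y v) (mulLL (Γ.pathSum mu u' x')
      (mulRR (Γ.pathSum mu y' v')
        (doubleBracket (Γ.edgeBracket K) (Γ.arrowHom lam e) (Γ.arrowHom mu f))))) =
    Γ.whiteCoeff K e.1 f.1 •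
      (Γ.pathFlow mu lam u' v e.1 ⊗ₜ[K] Γ.pathFlow lam mu u v' f.1) +
    Γ.blackCoeff K e.1 f.1 • (((mu / lam) ^ Γ.cross f.1 • Γ.pathFlow mu lam u' v f.1) ⊗ₜ[K]
      ((lam / mu) ^ Γ.cross e.1 • Γ.pathFlow lam mu u v' e.1)) := by
  have hbracket : doubleBracket (Γ.edgeBracket K) (Γ.arrowHom lam e) (Γ.arrowHom mu f) =
      (mu ^ Γ.cross f.1 * lam ^ Γ.cross e.1) •
        Γ.edgeBracket K (Γ.glueHom e) (Γ.glueHom f) := by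
    rw [← doubleBracket_toPath (Γ.edgeBracket K), arrowHom, arrowHom, map_smul, map_smul,
      LinearMap.smul_apply, smul_smul]
    rfl
  rw [hbracket, map_smul, map_smul, map_smul, map_smul,
    mul_edgeBracket (Γ.pathSum lam u) (Γ.pathSum lam · v) (Γ.pathSum mu u') (Γ.pathSum mu · v'),
    smul_pathFlow_hom hlam, smul_pathFlow_hom hmu]
  simp only [pathFlow_hom, arrowHom, map_smul, LinearMap.smul_apply, TensorProduct.smul_tmul',
    TensorProduct.tmul_smul, smul_add, smul_smul]
  congr 2 <;> ring_nf

theorem doubleBracket_pathSum (u v u' v' : Γ.Vertex) :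
    doubleBracket (Γ.edgeBracket K) (Γ.pathSum lam u v) (Γ.pathSum mu u' v') =
      ∑ e, ∑ f,
        (Γ.whiteCoeff K e f • (Γ.pathFlow mu lam u' v e ⊗ₜ[K] Γ.pathFlow lam mu u v' f) +
        Γ.blackCoeff K e f • (((mu / lam) ^ Γ.cross f • Γ.pathFlow mu lam u' v f) ⊗ₜ[K]
          ((lam / mu) ^ Γ.cross e • Γ.pathFlow lam mu u v' e))) := by
  rw [doubleBracket_resolvent_left (pathSum_eq_mul_edgeMatrix hlam)
    (pathSum_eq_edgeMatrix_mul hlam), ← Γ.sum_sum_sum_hom]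
  simp only [edgeMatrix, map_sum, LinearMap.sum_apply]
  refine Finset.sum_congr rfl fun x _ => Finset.sum_congr rfl fun y _ =>
    Finset.sum_congr rfl fun e _ => ?_
  rw [doubleBracket_resolvent_right (pathSum_eq_mul_edgeMatrix hmu)
    (pathSum_eq_edgeMatrix_mul hmu), ← Γ.sum_sum_sum_hom]
  simp only [edgeMatrix, map_sum, mul_doubleBracket_arrowHom hlam hmu]

theorem doubleBracket_boundaryMeasurement [NeZero (2 : K)] (hne : lam ≠ mu) (i j k l : Fin N) :
    doubleBracket (Γ.edgeBracket K) (Γ.boundaryMeasurement lam i j)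
      (Γ.boundaryMeasurement mu k l) =
      rhoCoeff lam mu i k • (Γ.boundaryMeasurement lam k j ⊗ₜ[K] Γ.boundaryMeasurement mu i l) -
      rhoCoeff lam mu l j •
        (Γ.boundaryMeasurement mu k j ⊗ₜ[K] Γ.boundaryMeasurement lam i l) := by
  refine finsuppTensorFinsupp'_ext fun P Q => ?_
  have hlocal := doubleBracket_pathSum hlam hmu
    (.source i : Γ.Vertex) (.sink j) (.source k) (.sink l)
  have hcoord (P : Quiver.Path (Γ.glueVertex (.source k)) (Γ.glueVertex (.sink j)))
      (Q : Quiver.Path (Γ.glueVertex (.source i)) (Γ.glueVertex (.sink l))) :=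
    DFunLike.congr_fun (congrArg (finsuppTensorFinsupp' K _ _) hlocal) (P, Q)
  simp only [map_sum, map_add, map_smul, Finsupp.coe_finsetSum, Finset.sum_apply,
    Finsupp.add_apply, Finsupp.smul_apply, smul_eq_mul, finsuppTensorFinsupp'_apply_apply,
    Finset.sum_add_distrib] at hcoord
  simp only [map_sub, map_smul, Finsupp.sub_apply, Finsupp.smul_apply, smul_eq_mul,
    finsuppTensorFinsupp'_apply_apply]
  exact (hcoord P Q).trans <| IsFlow.intersectionForm_eq hlam hmu hne
    (isFlow_pathFlow hmu hlam k j P) (isFlow_pathFlow hlam hmu i l Q)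

end CylindricalNetwork

/-! ## Polynomials in a matrix and brackets of their traces -/

section MatrixPolynomial

open Polynomial

variable {K : Type*} [Field K] {V : Type*} [Quiver V] {ι : Type*} {obj : ι → V} [Fintype ι]

section InsertedBracket

variable (β : ArrowBracket K V) {c d : V} (h : PathHom K c d)

/-- The sum of the brackets of the entries of `Z` with `h`, with the entries of the transpose of
`Y` inserted. For `Y = q'(Z)` it is the bracket of `tr q(Z)` with `h`. -/
def insertedBracket : PathMatrix K obj →ₗ[K] PathMatrix K obj →ₗ[K] PathHom K c d :=
  LinearMap.mk₂ K (fun Y Z => ∑ i, ∑ j, concatTensor (mulRL (Y j i) (doubleBracket β (Z i j) h)))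
    (fun Y Y' Z => by simp only [Pi.add_apply, mulRL_add, map_add, Finset.sum_add_distrib])
    (fun r Y Z => by
      simp only [Pi.smul_apply, mulRL, map_smul, LinearMap.rTensor_smul, LinearMap.smul_apply,
        Finset.smul_sum])
    (fun Y Z Z' => by
      simp only [Pi.add_apply, map_add, LinearMap.add_apply, Finset.sum_add_distrib])
    (fun r Y Z => by
      simp only [Pi.smul_apply, map_smul, LinearMap.smul_apply, Finset.smul_sum])

theorem insertedBracket_apply (Y Z : PathMatrix K obj) : insertedBracket β h Y Z =
    ∑ i, ∑ j, concatTensor (mulRL (Y j i) (doubleBracket β (Z i j) h)) := rfl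

theorem insertedBracket_mul (Y Z Z' : PathMatrix K obj) :
    insertedBracket β h Y (matrixMul Z Z') =
      insertedBracket β h (matrixMul Z' Y) Z + insertedBracket β h (matrixMul Y Z) Z' := by
  simp only [insertedBracket_apply, matrixMul_apply, map_sum, LinearMap.sum_apply,
    doubleBracket_concat_left, map_add, mulRL_sum, Finset.sum_add_distrib, mulRL_comp,
    ← mulLR_mulRL, concatTensor_mulLR]
  rw [add_comm]
  congr 1
  · exact Finset.sum_congr rfl fun i _ => Finset.sum_comm
  · rw [eq_comm]
    refine (Finset.sum_congr rfl fun i _ => Finset.sum_comm).trans (Finset.sum_comm.trans ?_)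
    exact Finset.sum_congr rfl fun i _ => Finset.sum_comm

theorem cyclicBracket_trace [DecidableEq ι] (k l : ι) (g : PathHom K (obj k) (obj l))
    (A : PathMatrix K obj) :
    cyclicBracket obj β k l (∑ i, cyc obj i (A i i)) g =
      insertedBracket β g (identityMatrix obj K) A := by
  simp only [map_sum, LinearMap.sum_apply, insertedBracket_apply, cyclicBracket_cyc]
  refine Finset.sum_congr rfl fun i _ => ?_
  rw [← map_sum, sum_mulRL_identityMatrix]
  rfl

end InsertedBracket

variable [DecidableEq ι]

section MatrixEval

variable (A : PathMatrix K obj)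

theorem matrixPow_succ (n : ℕ) : matrixPow A (n + 1) = matrixMul A (matrixPow A n) := rfl

theorem matrixPow_add (m n : ℕ) :
    matrixPow A (m + n) = matrixMul (matrixPow A m) (matrixPow A n) := by
  induction m with
  | zero => rw [zero_add, matrixPow, identityMatrix_mul]
  | succ m ih => rw [Nat.succ_add, matrixPow_succ, ih, matrixPow_succ, matrixMul_assoc]

/-- The value of a polynomial at a matrix of morphisms. -/
def matrixEval : K[X] →ₗ[K] PathMatrix K obj :=
  Polynomial.lsum fun n => LinearMap.toSpanSingleton K (PathMatrix K obj) (matrixPow A n)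

theorem matrixEval_monomial (n : ℕ) (r : K) :
    matrixEval A (monomial n r) = r • matrixPow A n := by
  simp [matrixEval, Polynomial.sum_monomial_index]

theorem matrixEval_mul (p q : K[X]) :
    matrixEval A (p * q) = matrixMul (matrixEval A p) (matrixEval A q) := by
  induction p using Polynomial.induction_on' with
  | add p p' hp hp' => simp only [add_mul, map_add, LinearMap.add_apply, hp, hp']
  | monomial m r =>
    induction q using Polynomial.induction_on' with
    | add q q' hq hq' => simp only [mul_add, map_add, hq, hq']
    | monomial n s =>
      simp only [monomial_mul_monomial, matrixEval_monomial, matrixPow_add, map_smul,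
        LinearMap.smul_apply, smul_smul, mul_comm]

theorem matrixEval_X_pow (n : ℕ) : matrixEval A (X ^ n) = matrixPow A n := by
  rw [X_pow_eq_monomial, matrixEval_monomial, one_smul]

theorem matrixEval_one : matrixEval A 1 = identityMatrix obj K := by
  rw [← pow_zero X, matrixEval_X_pow, matrixPow]

theorem matrixEval_X : matrixEval A X = A := by
  rw [← pow_one X, matrixEval_X_pow, matrixPow_succ, matrixPow, mul_identityMatrix]

variable {A} in
theorem PathIdeal.matrixEval_mem_of_dvd (J : PathIdeal K obj) (hA : ∀ i j, A i j ∈ J.carrier i j)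
    {m : ℕ} {p : K[X]} (hp : X ^ m ∣ p) (i j : ι) : matrixEval A p i j ∈ J.pow m i j := by
  obtain ⟨q, rfl⟩ := hp
  rw [matrixEval_mul, matrixEval_X_pow, matrixMul_apply]
  exact Submodule.sum_mem _ fun k _ => J.pow_concat_right _ (J.matrixPow_mem hA m i k)

variable (β : ArrowBracket K V) {c d : V} (h : PathHom K c d)

theorem insertedBracket_matrixPow (r : K[X]) (n : ℕ) :
    insertedBracket β h (matrixEval A r) (matrixPow A n) =
      insertedBracket β h (matrixEval A (r * derivative (X ^ n))) A := by
  induction n generalizing r with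
  | zero =>
    simp only [pow_zero, derivative_one, mul_zero, map_zero, LinearMap.zero_apply, matrixPow,
      insertedBracket_apply, doubleBracket_identityMatrix_left, Finset.sum_const_zero]
  | succ n ih =>
    have hrX : matrixMul (matrixEval A r) A = matrixEval A (r * X) := by
      rw [matrixEval_mul, matrixEval_X]
    have hXr : matrixMul (matrixPow A n) (matrixEval A r) = matrixEval A (X ^ n * r) := by
      rw [matrixEval_mul, matrixEval_X_pow]
    have hderiv : r * derivative (X ^ (n + 1)) = X ^ n * r + r * X * derivative (X ^ n) := by
      rw [pow_succ', derivative_mul, derivative_X]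
      ring
    rw [matrixPow_succ, insertedBracket_mul, hrX, hXr, ih, ← LinearMap.add_apply, ← map_add,
      ← map_add, hderiv]

theorem insertedBracket_matrixEval (q : K[X]) :
    insertedBracket β h (identityMatrix obj K) (matrixEval A q) =
      insertedBracket β h (matrixEval A (derivative q)) A := by
  induction q using Polynomial.induction_on' with
  | add p p' hp hp' => simp only [map_add, LinearMap.add_apply, hp, hp']
  | monomial n r =>
    have hpow := insertedBracket_matrixPow A β h 1 n
    rw [matrixEval_one, one_mul] at hpow
    rw [matrixEval_monomial, map_smul, hpow, ← smul_X_eq_monomial, derivative_smul, map_smul,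
      map_smul, LinearMap.smul_apply]

end MatrixEval

section Logarithm

/-- The logarithmic series `log (1 + X)`, truncated to the degrees smaller than `m`. -/
def logPoly (K : Type*) [Field K] (m : ℕ) : K[X] :=
  ∑ n ∈ Finset.range m, monomial n (if n = 0 then 0 else (-1) ^ (n + 1) / (n : K))

theorem logPoly_succ (m : ℕ) : logPoly K (m + 1) =
    logPoly K m + monomial m (if m = 0 then 0 else (-1) ^ (m + 1) / (m : K)) :=
  Finset.sum_range_succ _ _

theorem one_add_X_mul_derivative_logPoly [CharZero K] (m : ℕ) :
    (1 + X) * derivative (logPoly K (m + 1)) = 1 - (-X) ^ m := by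
  induction m with
  | zero => simp [logPoly]
  | succ m ih =>
    have hterm : derivative (monomial (m + 1) ((-1) ^ (m + 2) / ((m + 1 : ℕ) : K))) =
        (-X : K[X]) ^ m := by
      rw [derivative_monomial, div_mul_cancel₀ _ (Nat.cast_ne_zero.2 m.succ_ne_zero),
        Nat.add_sub_cancel, ← C_mul_X_pow_eq_monomial, neg_pow (X : K[X])]
      simp [pow_succ]
    rw [logPoly_succ, if_neg m.succ_ne_zero, map_add, mul_add, ih, hterm]
    ring

theorem X_pow_dvd_derivative_half_logPoly_sq [CharZero K] (m : ℕ) : (X : K[X]) ^ m ∣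
    (1 + X) * derivative ((1 / 2 : K) • (logPoly K (m + 1) * logPoly K (m + 1))) -
      logPoly K m := by
  have hderiv : derivative ((1 / 2 : K) • (logPoly K (m + 1) * logPoly K (m + 1))) =
      logPoly K (m + 1) * derivative (logPoly K (m + 1)) := by
    rw [derivative_smul, derivative_mul, mul_comm (derivative _), ← two_smul K, smul_smul,
      one_div_mul_cancel two_ne_zero, one_smul]
  have hsucc := logPoly_succ (K := K) m
  rw [← C_mul_X_pow_eq_monomial] at hsucc
  refine ⟨C (if m = 0 then 0 else (-1) ^ (m + 1) / (m : K)) - logPoly K (m + 1) * (-1) ^ m, ?_⟩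
  rw [hderiv, mul_left_comm, one_add_X_mul_derivative_logPoly, neg_pow (X : K[X])]
  linear_combination hsucc

end Logarithm

end MatrixPolynomial

namespace PathIdeal

open Polynomial

variable {K : Type*} [Field K] {V : Type*} [Quiver V] {ι : Type*} {obj : ι → V}
  (J : PathIdeal K obj)

theorem completion_sub_val {i j : ι} (x y : J.completion i j) (m : ℕ) :
    (x - y).1 m = x.1 m - y.1 m :=
  eq_sub_of_add_eq (congrFun (congrArg Subtype.val (sub_add_cancel x y)) m)

variable [Fintype ι]

theorem hatMul_val (A B : J.HatMatrix) (i j : ι) (m : ℕ) :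
    (J.hatMul A B i j).1 m = ∑ k, J.concatMod m i k j ((A i k).1 m) ((B k j).1 m) := by
  rw [hatMul, Submodule.coe_sum, Finset.sum_apply]
  rfl

variable [DecidableEq ι] {A : PathMatrix K obj} (hA : ∀ i j, A i j ∈ J.carrier i j)

theorem logOneAdd_val (i j : ι) (m : ℕ) :
    (J.logOneAdd A hA i j).1 m = (J.pow m i j).mkQ (matrixEval A (logPoly K m) i j) := by
  simp only [logPoly, map_sum (matrixEval A), matrixEval_monomial, Finset.sum_apply,
    Pi.smul_apply]
  rfl

/-- With `B = 1 + A`, this is the identity `log B = B f'(B)` for `f = 1/2 log²`. -/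
theorem logOneAdd_val_eq_one_add_mul_derivative [CharZero K] (i j : ι) (m : ℕ) :
    (J.logOneAdd A hA i j).1 m = (J.pow m i j).mkQ (matrixEval A ((1 + X) *
      derivative ((1 / 2 : K) • (logPoly K (m + 1) * logPoly K (m + 1)))) i j) := by
  rw [logOneAdd_val, eq_comm, ← sub_eq_zero, ← map_sub, ← Pi.sub_apply, ← Pi.sub_apply,
    ← map_sub, Submodule.mkQ_apply, Submodule.Quotient.mk_eq_zero]
  exact J.matrixEval_mem_of_dvd hA (X_pow_dvd_derivative_half_logPoly_sq m) i j

theorem hatMul_logOneAdd_val (i j : ι) (m : ℕ) :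
    (J.hatMul (J.logOneAdd A hA) (J.logOneAdd A hA) i j).1 m =
      (J.pow m i j).mkQ (matrixEval A (logPoly K m * logPoly K m) i j) := by
  rw [hatMul_val, matrixEval_mul, matrixMul_apply, map_sum]
  refine Finset.sum_congr rfl fun k _ => ?_
  rw [logOneAdd_val, logOneAdd_val, concatMod_mk]

theorem hatTrace_logOneAdd_sq_val (m : ℕ) :
    (J.hatTrace (J.hatMul (J.logOneAdd A hA) (J.logOneAdd A hA))).1 m =
      (J.cyclicPow m).mkQ (∑ i, cyc obj i (matrixEval A (logPoly K m * logPoly K m) i i)) := by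
  rw [hatTrace, Submodule.coe_sum, Finset.sum_apply, map_sum]
  refine Finset.sum_congr rfl fun i _ => ?_
  change Submodule.mapQ _ _ _ _ _ = _
  rw [hatMul_logOneAdd_val]
  rfl

end PathIdeal

/-! ## The Hamilton flow -/

namespace CylindricalNetwork

open Polynomial

variable {N : ℕ} {Γ : CylindricalNetwork N N} {K : Type*} [Field K] {lam mu : K}

theorem doubleBracket_shiftedMeasurement (β : ArrowBracket K Γ.TorusVertex)
    {c d : Γ.TorusVertex} (h : PathHom K c d) (i j : Fin N) :
    doubleBracket β (Γ.shiftedMeasurement lam i j) h =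
      doubleBracket β (Γ.boundaryMeasurement lam i j) h := by
  have hshift : Γ.boundaryMeasurement lam i j =
      Γ.shiftedMeasurement lam i j + identityMatrix Γ.marked K i j := (sub_add_cancel _ _).symm
  rw [hshift, map_add, LinearMap.add_apply,
    doubleBracket_identityMatrix_left (obj := Γ.marked), add_zero]

theorem matrixEval_one_add_X :
    matrixEval (Γ.shiftedMeasurement lam) (1 + X) = Γ.boundaryMeasurement lam := by
  rw [map_add, matrixEval_one, matrixEval_X]
  ext1 i; ext1 j
  exact add_sub_cancel _ _

section

variable (hlam : lam ≠ 0) (hmu : mu ≠ 0) (hne : lam ≠ mu)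
include hlam hmu hne

theorem insertedBracket_boundaryMeasurement [NeZero (2 : K)] (Y : PathMatrix K Γ.marked)
    (k l : Fin N) :
    insertedBracket (Γ.edgeBracket K) (Γ.boundaryMeasurement mu k l) Y
      (Γ.shiftedMeasurement lam) =
      ∑ i, concat (rhoCoeff lam mu i k • matrixMul (Γ.boundaryMeasurement lam) Y k i)
        (Γ.boundaryMeasurement mu i l) -
      ∑ j, concat (Γ.boundaryMeasurement mu k j)
        (rhoCoeff lam mu l j • matrixMul Y (Γ.boundaryMeasurement lam) j l) := by
  simp only [insertedBracket_apply, doubleBracket_shiftedMeasurement,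
    doubleBracket_boundaryMeasurement hlam hmu hne, map_sub, map_smul, mulRL,
    LinearMap.rTensor_tmul, LinearMap.flip_apply, concatTensor, TensorProduct.lift.tmul,
    matrixMul_apply, Finset.sum_sub_distrib, map_sum, LinearMap.sum_apply, LinearMap.smul_apply,
    Finset.smul_sum, concat_assoc]
  congr 1
  exact Finset.sum_comm

theorem cyclicBracket_trace_matrixEval [NeZero (2 : K)] (q : K[X]) (k l : Fin N) :
    cyclicBracket Γ.marked (Γ.edgeBracket K) k l
        (∑ i, cyc Γ.marked i (matrixEval (Γ.shiftedMeasurement lam) q i i))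
        (Γ.boundaryMeasurement mu k l) =
      ∑ i, concat (rhoCoeff lam mu i k •
          matrixEval (Γ.shiftedMeasurement lam) ((1 + X) * derivative q) k i)
        (Γ.boundaryMeasurement mu i l) -
      ∑ j, concat (Γ.boundaryMeasurement mu k j) (rhoCoeff lam mu l j •
        matrixEval (Γ.shiftedMeasurement lam) ((1 + X) * derivative q) j l) := by
  have hleft : matrixMul (Γ.boundaryMeasurement lam)
      (matrixEval (Γ.shiftedMeasurement lam) (derivative q)) =
        matrixEval (Γ.shiftedMeasurement lam) ((1 + X) * derivative q) := by
    rw [matrixEval_mul, matrixEval_one_add_X]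
  have hright : matrixMul (matrixEval (Γ.shiftedMeasurement lam) (derivative q))
      (Γ.boundaryMeasurement lam) =
        matrixEval (Γ.shiftedMeasurement lam) ((1 + X) * derivative q) := by
    rw [mul_comm, matrixEval_mul, matrixEval_one_add_X]
  rw [cyclicBracket_trace, insertedBracket_matrixEval,
    insertedBracket_boundaryMeasurement hlam hmu hne, hleft, hright]

end

variable (J : PathIdeal K Γ.marked)
  (hJ : ∀ i j : Fin N, Γ.shiftedMeasurement lam i j ∈ J.carrier i j)

theorem hamiltonian_val (m : ℕ) : (Γ.hamiltonian J hJ).1 m =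
    (J.cyclicPow m).mkQ (∑ i, cyc Γ.marked i (matrixEval (Γ.shiftedMeasurement lam)
      ((1 / 2 : K) • (logPoly K m * logPoly K m)) i i)) := by
  rw [hamiltonian, Submodule.coe_smul, Pi.smul_apply, logMeasurement,
    PathIdeal.hatTrace_logOneAdd_sq_val]
  simp only [map_smul, Pi.smul_apply, ← Finset.smul_sum]

theorem laxMatrix_val [CharZero K] (mu : K) (i j : Fin N) (m : ℕ) :
    (Γ.laxMatrix J hJ mu i j).1 m =
      (J.pow m i j).mkQ (rhoCoeff lam mu j i • matrixEval (Γ.shiftedMeasurement lam)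
        ((1 + X) * derivative ((1 / 2 : K) • (logPoly K (m + 1) * logPoly K (m + 1)))) i j) := by
  rw [map_smul, ← J.logOneAdd_val_eq_one_add_mul_derivative hJ]
  rfl

end CylindricalNetwork

theorem mainTheorem6_general {K : Type*} [Field K] [CharZero K] {lam mu : K} (hlam : lam ≠ 0)
    (hmu : mu ≠ 0) (hne : lam ≠ mu) {N : ℕ} (Γ : CylindricalNetwork N N)
    (J : PathIdeal K Γ.marked)
    (hJ : ∀ i j : Fin N, Γ.shiftedMeasurement lam i j ∈ J.carrier i j) (b₁ b₂ : Fin N) :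
    J.hatBracket (Γ.edgeBracket K) (Γ.hamiltonian J hJ) (Γ.hatMeasurement J mu b₁ b₂) =
      J.hatMul (Γ.laxMatrix J hJ mu) (Γ.hatMeasurement J mu) b₁ b₂ -
        J.hatMul (Γ.hatMeasurement J mu) (Γ.laxMatrix J hJ mu) b₁ b₂ := by
  refine Subtype.ext (funext fun m => ?_)
  have hmeas (i j : Fin N) : (Γ.hatMeasurement J mu i j).1 m =
      (J.pow m i j).mkQ (Γ.boundaryMeasurement mu i j) := rfl
  rw [J.completion_sub_val, J.hatMul_val, J.hatMul_val]
  change J.bracketMod _ m b₁ b₂ ((Γ.hamiltonian J hJ).1 (m + 1)) _ = _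
  simp only [CylindricalNetwork.laxMatrix_val, hmeas, J.concatMod_mk]
  rw [CylindricalNetwork.hamiltonian_val, ← map_sum, ← map_sum, ← map_sub,
    ← CylindricalNetwork.cyclicBracket_trace_matrixEval hlam hmu hne]
  rfl

theorem spectralLam_ne_zero : spectralLam ≠ 0 := by
  rw [spectralLam, Ne, IsFractionRing.to_map_eq_zero_iff]
  exact MvPolynomial.X_ne_zero 0

theorem spectralMu_ne_zero : spectralMu ≠ 0 := by
  rw [spectralMu, Ne, IsFractionRing.to_map_eq_zero_iff]
  exact MvPolynomial.X_ne_zero 1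

theorem spectralLam_ne_spectralMu : spectralLam ≠ spectralMu := fun h =>
  absurd (MvPolynomial.X_injective (IsFractionRing.injective _ _ h)) (by decide)

instance : CharZero SpectralField :=
  charZero_of_injective_algebraMap (IsFractionRing.injective (MvPolynomial (Fin 2) ℂ) _)

end

theorem mainTheorem6 (N : ℕ) (Γ : CylindricalNetwork N N)
    (J : PathIdeal SpectralField Γ.marked)
    (hJ : ∀ i j : Fin N, Γ.shiftedMeasurement spectralLam i j ∈ J.carrier i j)
    (b₁ b₂ : Fin N) :
    J.hatBracket (Γ.edgeBracket SpectralField) (Γ.hamiltonian J hJ)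
        (Γ.hatMeasurement J spectralMu b₁ b₂) =
      J.hatMul (Γ.laxMatrix J hJ spectralMu) (Γ.hatMeasurement J spectralMu) b₁ b₂ -
        J.hatMul (Γ.hatMeasurement J spectralMu) (Γ.laxMatrix J hJ spectralMu) b₁ b₂ :=
  mainTheorem6_general spectralLam_ne_zero spectralMu_ne_zero spectralLam_ne_spectralMu Γ J hJ
    b₁ b₂
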